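/- **Setting.** Let $N$ be a lattice (a free abelian group of finite rank), $M=\mathrm{Hom}(N,\mathbb Z)$, $N_{\mathbb R}=\mathbb R\otimes_{\mathbb Z}N$, $T_N=\mathrm{Spec}\,\mathbb C[M]$. A *fan* in $N$ is a finite nonempty set $\Delta$ of strictly convex rational polyhedral cones in $N_{\mathbb R}$ that contains every face of each of its members and satisfies: for $\sigma,\sigma'\in\Delta$ the intersection $\sigma\cap\sigma'$ is a face of $\sigma$. A *system of fans* is a family $\mathcal S=(\Delta_{ij})_{i,j\in I}$ of fans in $N$, with $I$ finite and nonempty, such that $\Delta_{ij}=\Delta_{ji}$ and $\Delta_{ij}\cap\Delta_{jk}$ is a subfan of $\Delta_{ik}$ for all $i,j,k$. It is *affine* if every $\Delta_{ii}$ is the fan $\mathfrak F(\sigma_{ii})$ of faces of a single cone $\sigma_{ii}$, and *simplicial* if each cone of each $\Delta_{ij}$ is generated by linearly independent vectors. An affine system $\mathcal S$ defines a scheme $X_{\mathcal S}$ over $\mathbb C$ with an action of $T_N$ and a base point: for $i\in I$ and $\tau\in\Delta_{ii}$ let $X_{[\tau,i]}=\mathrm{Spec}\,\mathbb C[\tau^\vee\cap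 M]$, and glue the charts $X_{[\sigma_{ii},i]}$ and $X_{[\sigma_{jj},j]}$ along the union of their open subschemes $X_{[\tau,i]}=X_{[\tau,j]}$, $\tau\in\Delta_{ij}$. A *toric prevariety* with torus $T=T_{N'}$ is an integral normal scheme $X$ of finite type over $\mathbb C$, not necessarily separated, with an action of $T$ and a base point $x_0\in X(\mathbb C)$ such that the orbit map $T\to X$, $t\mapsto t\cdot x_0$, is an open embedding and $X$ is covered by $T$-stable affine charts (i.e. $T$-stable open affine subschemes). A *toric morphism* is a morphism over $\mathbb C$ that maps base point to base point and is equivariant with respect to a homomorphism of the acting tori. A toric prevariety is *of affine intersection* if for any two maximal $T$-stable affine charts $U,U'$ the intersection $U\cap U'$ is affine. **Proposition 1.1.** Let $\mathcal S=(\Delta_{ij})_{i,j\in I}$ be a simplicial affine system of fans in $N$. For $i,j\in I$ let $|\Delta_{ij}|$ be the union of the cones of $\Delta_{ij}$ and set $$\tilde\sigma_{ij}:=\mathrm{conv}(|\Delta_{ij}|),\qquad \tilde\Delta_{ij}:=\mathfrak F(\tilde\sigma_{ij}),\qquad \tilde{\mathcal S}:=(\tilde\Delta_{ij})_{i,j\in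 I}.$$ Then $\tilde{\mathcal S}$ is again a simplicial affine system of fans in $N$, with $\Delta_{ij}\subset\tilde\Delta_{ij}$. Let $g:X_{\mathcal S}\to X_{\tilde{\mathcal S}}$ be the morphism associated to the identity maps of $N$ and $I$, which maps each chart $X_{[\tau,i]}$ of $X_{\mathcal S}$ identically to the chart $X_{[\tau,i]}$ of $X_{\tilde{\mathcal S}}$. Then $X_{\mathcal S}$ and $X_{\tilde{\mathcal S}}$ are toric prevarieties, $X_{\tilde{\mathcal S}}$ is of affine intersection, $g$ is a toric morphism, and: 1. for every $i\in I$, $g$ restricts to an isomorphism from $X_{[\sigma_{ii},i]}$ onto $X_{[\tilde\sigma_{ii},i]}$; 2. for every $i\in I$, $g^{-1}(X_{[\tilde\sigma_{ii},i]})=\bigcup_{j\in I}X_{[\tilde\sigma_{ij},j]}$, where $X_{[\tilde\sigma_{ij},j]}$ is a chart of $X_{\mathcal S}$; 3. $g$ is universal with respect to toric morphisms from $X_{\mathcal S}$ into toric prevarieties of affine intersection: for every toric prevariety $Y$ of affine intersection (with any acting torus) and every toric morphism $f:X_{\mathcal S}\to Y$ there is exactly one toric morphism $\tilde f:X_{\tilde{\mathcal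 S}}\to Y$ with $f=\tilde f\circ g$; 4. if $X_{\mathcal S}$ is smooth over $\mathbb C$, then so is $X_{\tilde{\mathcal S}}$. -/

import Mathlib

open CategoryTheory CategoryTheory.Limits AlgebraicGeometry TensorProduct
open MonoidalCategory CartesianMonoidalCategory

noncomputable section

namespace ToricPrevarieties

/-! ### Convex geometry -/

section Convex

variable {E : Type*} [AddCommGroup E] [Module ℝ E]

/-- A face of a cone spanned by `g` is spanned by the generators it contains. -/
lemma face_eq_hull_inter {g : Set E} {F : PointedCone ℝ E}
    (hF : F.IsFaceOf (PointedCone.hull ℝ g)) : F = PointedCone.hull ℝ (g ∩ F) := by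
  refine le_antisymm (fun x hx => ?_) (Submodule.span_le.2 Set.inter_subset_right)
  have key : ∀ y ∈ PointedCone.hull ℝ g, y ∈ F → y ∈ PointedCone.hull ℝ (g ∩ F) := by
    intro y hy
    induction hy using Submodule.span_induction with
    | mem y h => exact fun h' => Submodule.subset_span ⟨h, h'⟩
    | zero => exact fun _ => zero_mem _
    | add y z hy hz ihy ihz =>
      intro h
      exact add_mem (ihy (hF.mem_of_add_mem_left hy hz h)) (ihz (hF.mem_of_add_mem_right hy hz h))
    | smul r y hy ih =>
      intro h
      rcases eq_or_ne r 0 with rfl | hr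
      · simp
      · have h2 := Submodule.smul_mem F r⁻¹ h
        rw [smul_smul, inv_mul_cancel₀ hr, one_smul] at h2
        exact Submodule.smul_mem _ r (ih h2)
  exact key x (hF.le hx) hx

lemma nonneg_of_mem_hull {g : Set E} {u : E →ₗ[ℝ] ℝ} (hu : ∀ b ∈ g, 0 ≤ u b) {x : E}
    (hx : x ∈ PointedCone.hull ℝ g) : 0 ≤ u x := by
  induction hx using Submodule.span_induction with
  | mem y h => exact hu y h
  | zero => simp
  | add y z hy hz ihy ihz => rw [map_add]; exact add_nonneg ihy ihz
  | smul r y hy ih =>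
    have : u (r • y) = (r : ℝ) * u y := by
      rw [← smul_eq_mul, ← map_smul]; rfl
    rw [this]; exact mul_nonneg r.2 ih

lemma mem_hull_of_form_eq_zero {g : Set E} {u : E →ₗ[ℝ] ℝ} (hu : ∀ b ∈ g, 0 ≤ u b) {x : E}
    (hx : x ∈ PointedCone.hull ℝ g) (h0 : u x = 0) :
    x ∈ PointedCone.hull ℝ (g ∩ {b | u b = 0}) := by
  induction hx using Submodule.span_induction with
  | mem y h => exact Submodule.subset_span ⟨h, h0⟩
  | zero => exact zero_mem _
  | add y z hy hz ihy ihz =>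
    rw [map_add] at h0
    have h1 := nonneg_of_mem_hull hu hy
    have h2 := nonneg_of_mem_hull hu hz
    exact add_mem (ihy (by linarith)) (ihz (by linarith))
  | smul r y hy ih =>
    have : u (r • y) = (r : ℝ) * u y := by
      rw [← smul_eq_mul, ← map_smul]; rfl
    rw [this] at h0
    rcases mul_eq_zero.1 h0 with h | h
    · have : r = 0 := by ext; exact h
      subst this; simp
    · exact Submodule.smul_mem _ r (ih h)

lemma exists_linearMap_of_linearIndependent {K V J : Type*} [Field K] [AddCommGroup V] [Module K V]
    {v : J → V} (hv : LinearIndependent K v) (f : J → K) :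
    ∃ u : V →ₗ[K] K, ∀ i, u (v i) = f i := by
  obtain ⟨u, hu⟩ := LinearMap.exists_extend ((Module.Basis.span hv).constr K f)
  refine ⟨u, fun i => ?_⟩
  have h1 := (Module.Basis.span hv).constr_basis K f i
  rw [← hu] at h1
  simpa [Module.Basis.span_apply] using h1

/-- A linear form vanishing on `t` and positive on `s \ t`. -/
lemma exists_form_of_linearIndepOn {s : Set E} (hs : LinearIndepOn ℝ id s) (t : Set E) :
    ∃ u : E →ₗ[ℝ] ℝ, (∀ b ∈ s, 0 ≤ u b) ∧ ∀ b ∈ s, u b = 0 ↔ b ∈ t := by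
  classical
  have hs' : LinearIndependent ℝ ((↑) : s → E) := hs
  obtain ⟨u, hu'⟩ := exists_linearMap_of_linearIndependent hs'
    (fun b => if (b : E) ∈ t then (0 : ℝ) else 1)
  have hu : ∀ b ∈ s, u b = if b ∈ t then 0 else 1 := fun b hb => hu' ⟨b, hb⟩
  refine ⟨u, fun b hb => ?_, fun b hb => ?_⟩
  · rw [hu b hb]; split_ifs <;> norm_num
  · rw [hu b hb]; split_ifs with h <;> simp [h]

/-- A subset of the linearly independent generators of a cone spans a face. -/
lemma hull_isFaceOf_hull {s t : Set E} (hs : LinearIndepOn ℝ id s) (ht : t ⊆ s) :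
    (PointedCone.hull ℝ t).IsFaceOf (PointedCone.hull ℝ s) := by
  obtain ⟨u, hu, hut⟩ := exists_form_of_linearIndepOn hs t
  have hst : s ∩ {b | u b = 0} = t := by
    ext b; constructor
    · rintro ⟨h1, h2⟩; exact (hut b h1).1 h2
    · intro h; exact ⟨ht h, (hut b (ht h)).2 h⟩
  have key : ∀ x ∈ PointedCone.hull ℝ s, x ∈ PointedCone.hull ℝ t ↔ u x = 0 := by
    intro x hx
    constructor
    · intro h
      have h1 := nonneg_of_mem_hull hu hx
      have h2 : 0 ≤ (-u) x := nonneg_of_mem_hull (g := t)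
        (fun b hb => by simp [(hut b (ht hb)).2 hb]) h
      simp only [LinearMap.neg_apply] at h2
      linarith
    · intro h
      have := mem_hull_of_form_eq_zero hu hx h
      rwa [hst] at this
  refine ⟨Submodule.span_mono ht, ?_⟩
  intro x y a hx hy ha hxy
  have h1 := nonneg_of_mem_hull hu hx
  have h2 := nonneg_of_mem_hull hu hy
  have h3 := (key _ (Submodule.span_mono ht hxy)).1 hxy
  rw [map_add, map_smul, smul_eq_mul] at h3
  have : 0 ≤ a * u x := mul_nonneg ha.le h1
  have : a * u x = 0 := by linarith
  exact (key x hx).2 ((mul_eq_zero.1 this).resolve_left ha.ne')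

lemma mem_of_mem_hull_of_linearIndepOn {s t : Set E} (hs : LinearIndepOn ℝ id s) (ht : t ⊆ s)
    {b : E} (hb : b ∈ s) (h : b ∈ PointedCone.hull ℝ t) : b ∈ t := by
  obtain ⟨u, hu, hut⟩ := exists_form_of_linearIndepOn hs t
  have h1 := hu b hb
  have h2 : 0 ≤ (-u) b := nonneg_of_mem_hull (g := t)
    (fun b hb => by simp [(hut b (ht hb)).2 hb]) h
  simp only [LinearMap.neg_apply] at h2
  exact (hut b hb).1 (by linarith)

lemma isSimplicial_of_isFaceOf {F σ : PointedCone ℝ E} (hF : F.IsFaceOf σ)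
    (hσ : σ.IsSimplicial) : F.IsSimplicial := by
  obtain ⟨s, hfin, hli, rfl⟩ := hσ
  exact ⟨s ∩ F, hfin.inter_of_left _, hli.mono Set.inter_subset_left, (face_eq_hull_inter hF).symm⟩

lemma finite_faces {g : Set E} (hg : g.Finite) :
    {F : PointedCone ℝ E | F.IsFaceOf (PointedCone.hull ℝ g)}.Finite := by
  refine (hg.finite_subsets.image (fun t => PointedCone.hull ℝ t)).subset ?_
  intro F hF
  exact ⟨g ∩ F, Set.inter_subset_left, (face_eq_hull_inter hF).symm⟩

open scoped Pointwise in
/-- The cone spanned by a nonempty union of cones is the convex hull of that union. -/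
lemma coe_hull_biUnion {C : Set (PointedCone ℝ E)} (hC : C.Nonempty) :
    (PointedCone.hull ℝ (⋃ σ ∈ C, (σ : Set E)) : Set E) =
      convexHull ℝ (⋃ σ ∈ C, (σ : Set E)) := by
  apply Set.Subset.antisymm
  · set A : Set E := ⋃ σ ∈ C, (σ : Set E) with hA
    have hsm : ∀ (r : ℝ), 0 ≤ r → ∀ x ∈ convexHull ℝ A, r • x ∈ convexHull ℝ A := by
      intro r hr x hx
      have h1 : r • x ∈ r • convexHull ℝ A := Set.smul_mem_smul_set hx
      rw [← convexHull_smul] at h1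
      refine convexHull_mono ?_ h1
      rintro _ ⟨y, hy, rfl⟩
      simp only [hA, Set.mem_iUnion] at hy ⊢
      obtain ⟨σ, hσ, hy⟩ := hy
      exact ⟨σ, hσ, PointedCone.smul_mem σ hr hy⟩
    intro x hx
    simp only [SetLike.mem_coe] at hx
    induction hx using Submodule.span_induction with
    | mem y h => exact subset_convexHull ℝ _ h
    | zero =>
      obtain ⟨σ, hσ⟩ := hC
      exact subset_convexHull ℝ _ (Set.mem_biUnion hσ (zero_mem σ))
    | add y z hy hz ihy ihz =>
      have h := (convex_convexHull ℝ A) ihy ihz (a := 1/2) (b := 1/2)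
        (by norm_num) (by norm_num) (by norm_num)
      have := hsm 2 (by norm_num) _ h
      simpa [smul_add, smul_smul] using this
    | smul r y hy ih => exact hsm r r.2 y ih
  · exact convexHull_min Submodule.subset_span (PointedCone.convex _)

end Convex

/-! ### Cones, fans and systems of fans in a lattice -/

section Fans

variable (N : Type) [AddCommGroup N]

/-- The real vector space `N_ℝ = ℝ ⊗ N` of a lattice `N`. -/
abbrev RealSpace : Type := ℝ ⊗[ℤ] N

variable {N}

/-- A cone `σ ⊆ N_ℝ` is a rational polyhedral cone ("a cone in `N`") if it is generated by finitely
many lattice vectors. -/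
def IsRationalCone (σ : PointedCone ℝ (RealSpace N)) : Prop :=
  ∃ B : Set N, B.Finite ∧ PointedCone.hull ℝ ((fun v : N => (1 : ℝ) ⊗ₜ[ℤ] v) '' B) = σ

/-- The real extension `N_ℝ → ℝ` of a character `m ∈ M = Hom(N, ℤ)`. -/
def pairing (m : Module.Dual ℤ N) : RealSpace N →ₗ[ℝ] ℝ :=
  m.baseChange ℝ

@[simp]
lemma pairing_tmul (m : Module.Dual ℤ N) (r : ℝ) (v : N) : pairing m (r ⊗ₜ v) = (m v : ℝ) * r := by
  simp [pairing]

lemma pairing_one_tmul (m : Module.Dual ℤ N) (v : N) : pairing m ((1 : ℝ) ⊗ₜ v) = (m v : ℝ) := by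
  simp [pairing]

@[simp]
lemma pairing_zero : pairing (0 : Module.Dual ℤ N) = 0 := by
  simp [pairing]

@[simp]
lemma pairing_add (m m' : Module.Dual ℤ N) : pairing (m + m') = pairing m + pairing m' := by
  ext; simp

@[simp]
lemma pairing_neg (m : Module.Dual ℤ N) : pairing (-m) = -pairing m := by
  ext; simp

/-- The monoid `σ^∨ ∩ M` of characters that are nonnegative on the cone `σ`. -/
def dualMonoid (σ : PointedCone ℝ (RealSpace N)) : AddSubmonoid (Module.Dual ℤ N) where
  carrier := {m | ∀ x ∈ σ, 0 ≤ pairing m x}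
  zero_mem' := by simp
  add_mem' := by
    intro a b ha hb x hx
    simpa using add_nonneg (ha x hx) (hb x hx)

lemma dualMonoid_anti {τ σ : PointedCone ℝ (RealSpace N)} (h : τ ≤ σ) :
    dualMonoid σ ≤ dualMonoid τ := fun _ hm x hx => hm x (h hx)

lemma isRationalCone_of_isFaceOf {F σ : PointedCone ℝ (RealSpace N)} (hF : F.IsFaceOf σ)
    (hσ : IsRationalCone σ) : IsRationalCone F := by
  obtain ⟨B, hB, rfl⟩ := hσ
  refine ⟨{v ∈ B | (1 : ℝ) ⊗ₜ[ℤ] v ∈ F}, hB.subset (Set.sep_subset _ _), ?_⟩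
  conv_rhs => rw [face_eq_hull_inter hF]
  congr 1
  ext x; constructor
  · rintro ⟨v, ⟨h1, h2⟩, rfl⟩; exact ⟨⟨v, h1, rfl⟩, h2⟩
  · rintro ⟨⟨v, h1, rfl⟩, h2⟩; exact ⟨v, ⟨h1, h2⟩, rfl⟩

/-- Each generator of a rational simplicial cone is a positive multiple of a lattice vector. -/
lemma exists_lattice_generator {s : Set (RealSpace N)} (hs : LinearIndepOn ℝ id s)
    (hr : IsRationalCone (PointedCone.hull ℝ s)) {b : RealSpace N} (hb : b ∈ s) :
    ∃ (v : N) (c : ℝ), 0 < c ∧ (1 : ℝ) ⊗ₜ[ℤ] v = c • b := by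
  obtain ⟨B, -, hB⟩ := hr
  have hface := hull_isFaceOf_hull hs (Set.singleton_subset_iff.2 hb)
  have hb0 : b ≠ 0 := hs.ne_zero hb
  rw [← hB] at hface
  have h1 := face_eq_hull_inter hface
  by_contra! hcon
  have h2 : PointedCone.hull ℝ ((fun v : N => (1 : ℝ) ⊗ₜ[ℤ] v) '' B ∩
      (PointedCone.hull ℝ {b} : Set (RealSpace N))) ≤ ⊥ := by
    refine Submodule.span_le.2 ?_
    rintro _ ⟨⟨v, hv, rfl⟩, hvb⟩
    obtain ⟨c, hc⟩ := Submodule.mem_span_singleton.1 hvb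
    by_cases hc0 : c = 0
    · subst hc0
      simpa using hc.symm
    · exact absurd hc.symm (hcon v c (lt_of_le_of_ne c.2 (fun h => hc0 (Subtype.ext h.symm))))
  rw [← h1] at h2
  exact hb0 (by simpa using h2 (Submodule.subset_span rfl))

/-- A face of a simplicial cone in `N` is cut out by a lattice character. -/
lemma exists_character_of_isFaceOf [Module.Free ℤ N] [Module.Finite ℤ N]
    {F σ : PointedCone ℝ (RealSpace N)} (hF : F.IsFaceOf σ)
    (hs : σ.IsSimplicial) (hr : IsRationalCone σ) :
    ∃ m ∈ dualMonoid σ, ∀ x ∈ σ, x ∈ F ↔ pairing m x = 0 := by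
  classical
  obtain ⟨s, hfin, hli, rfl⟩ := hs
  have hex : ∀ b : s, ∃ (v : N) (c : ℝ), 0 < c ∧ (1 : ℝ) ⊗ₜ[ℤ] v = c • (b : RealSpace N) :=
    fun b => exists_lattice_generator hli hr b.2
  choose v c hc hv using hex
  have hli' : LinearIndependent ℝ ((↑) : s → RealSpace N) := hli
  have h1 : LinearIndependent ℝ (fun b : s => (1 : ℝ) ⊗ₜ[ℤ] v b) := by
    have := hli'.units_smul (fun b => Units.mk0 (c b) (hc b).ne')
    convert this using 1
    ext b
    simp [hv]
  have h2 : LinearIndependent ℤ v := by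
    have h := h1.restrict_scalars (R := ℤ) (by
      intro a b h; simpa using h)
    exact LinearIndependent.of_comp (TensorProduct.mk ℤ ℝ N 1) h
  have h3 : LinearIndependent ℚ (fun b : s => (1 : ℚ) ⊗ₜ[ℤ] v b) :=
    h2.of_isLocalizedModule ℚ (nonZeroDivisors ℤ) (TensorProduct.mk ℤ ℚ N 1)
  obtain ⟨u, hu⟩ := exists_linearMap_of_linearIndependent h3
    (fun b : s => if (b : RealSpace N) ∈ F then (0 : ℚ) else 1)
  let e := Module.Free.chooseBasis ℤ N
  obtain ⟨⟨d, hd⟩, hd'⟩ := IsLocalization.exist_integer_multiples_of_finite (nonZeroDivisors ℤ)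
    (fun i => u ((1 : ℚ) ⊗ₜ e i))
  choose f hf using hd'
  have hd0 : d ≠ 0 := nonZeroDivisors.ne_zero hd
  let m₀ : N →ₗ[ℤ] ℤ := e.constr ℤ f
  have hm₀ : ∀ w : N, (m₀ w : ℚ) = d * u ((1 : ℚ) ⊗ₜ w) := by
    intro w
    have : (Algebra.linearMap ℤ ℚ) ∘ₗ m₀ =
        d • ((u.restrictScalars ℤ) ∘ₗ (TensorProduct.mk ℤ ℚ N 1)) := by
      refine e.ext fun i => ?_
      have := hf i
      simp [m₀] at this ⊢
      exact this
    have h := LinearMap.congr_fun this w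
    exact (by simpa using h : (m₀ w : ℚ) =
      d * ((u.restrictScalars ℤ) ∘ₗ (TensorProduct.mk ℤ ℚ N 1)) w)
  let m : Module.Dual ℤ N := d • m₀
  have hm : ∀ b : s, (m (v b) : ℝ) = if (b : RealSpace N) ∈ F then 0 else (d : ℝ) ^ 2 := by
    intro b
    have h4 := hm₀ (v b)
    rw [hu b] at h4
    split_ifs at h4 ⊢ with hb
    · have : m₀ (v b) = 0 := by exact_mod_cast (by simpa using h4 : (m₀ (v b) : ℚ) = 0)
      simp [m, this]
    · have : m₀ (v b) = d := by exact_mod_cast (by simpa using h4 : (m₀ (v b) : ℚ) = d)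
      simp [m, this, sq]
  have hmb : ∀ b : s, c b * pairing m b = if (b : RealSpace N) ∈ F then 0 else (d : ℝ) ^ 2 := by
    intro b
    rw [← hm b, ← smul_eq_mul, ← map_smul, ← hv b]
    simp
  have hd2 : 0 < (d : ℝ) ^ 2 := by
    have : (d : ℝ) ≠ 0 := by exact_mod_cast hd0
    positivity
  have hnn : ∀ b ∈ s, 0 ≤ pairing m b := by
    intro b hb
    have h5 := hmb ⟨b, hb⟩
    refine nonneg_of_mul_nonneg_right ?_ (hc ⟨b, hb⟩)
    rw [h5]
    split_ifs
    · exact le_rfl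
    · exact hd2.le
  have hz : ∀ b ∈ s, pairing m b = 0 ↔ b ∈ F := by
    intro b hb
    have h5 := hmb ⟨b, hb⟩
    split_ifs at h5 with h6
    · exact ⟨fun _ => h6, fun _ => (mul_eq_zero.1 h5).resolve_left (hc _).ne'⟩
    · refine ⟨fun h7 => ?_, fun h => absurd h h6⟩
      simp only [h7, mul_zero] at h5
      exact absurd h5 hd2.ne
  have hsF : s ∩ {b | pairing m b = 0} = s ∩ F := by
    ext b
    exact and_congr_right fun hb => hz b hb
  refine ⟨m, fun x hx => nonneg_of_mem_hull hnn hx, fun x hx => ⟨fun h => ?_, fun h => ?_⟩⟩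
  · rw [face_eq_hull_inter hF] at h
    have h1 := nonneg_of_mem_hull hnn hx
    have h2 : 0 ≤ (-pairing m) x := nonneg_of_mem_hull (g := s ∩ F)
      (fun b hb => by simp [(hz b hb.1).2 hb.2]) h
    simp only [LinearMap.neg_apply] at h2
    linarith
  · have h1 := mem_hull_of_form_eq_zero hnn hx h
    rw [hsF, ← face_eq_hull_inter hF] at h1
    exact h1

/-- Every character that is nonnegative on a face becomes nonnegative on the whole cone after adding
a multiple of a character that cuts out the face. -/
lemma exists_nsmul_add_mem_dualMonoid {F σ : PointedCone ℝ (RealSpace N)} (hr : IsRationalCone σ)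
    {m : Module.Dual ℤ N} (hm : m ∈ dualMonoid σ) (hmF : ∀ x ∈ σ, x ∈ F ↔ pairing m x = 0)
    {u : Module.Dual ℤ N} (hu : u ∈ dualMonoid F) :
    ∃ k₀ : ℕ, ∀ k, k₀ ≤ k → u + k • m ∈ dualMonoid σ := by
  obtain ⟨B, hB, rfl⟩ := hr
  refine ⟨hB.toFinset.sup fun v => (u v).natAbs, fun k hk x hx => ?_⟩
  refine nonneg_of_mem_hull ?_ hx
  rintro _ ⟨v, hv, rfl⟩
  have hmem : (1 : ℝ) ⊗ₜ[ℤ] v ∈ PointedCone.hull ℝ ((fun v : N => (1 : ℝ) ⊗ₜ[ℤ] v) '' B) :=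
    Submodule.subset_span ⟨v, hv, rfl⟩
  have h1 := hm _ hmem
  have h2 := hmF _ hmem
  have hk' : (u v).natAbs ≤ k :=
    (Finset.le_sup (f := fun v => (u v).natAbs) (hB.mem_toFinset.2 hv)).trans hk
  simp only [pairing_one_tmul] at h1 h2 ⊢
  simp only [LinearMap.add_apply, LinearMap.smul_apply, nsmul_eq_mul]
  rcases eq_or_ne (m v) 0 with h0 | h0
  · have h3 := hu _ (h2.2 (by simp [h0]))
    simpa [h0] using h3
  · have h4 : 0 ≤ m v := by exact_mod_cast h1
    have h5 : 1 ≤ m v := by omega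
    have h6 : (0 : ℤ) ≤ u v + k * m v := by
      have : (k : ℤ) ≤ k * m v := by nlinarith
      omega
    exact_mod_cast h6

lemma salient_of_isSimplicial {E : Type*} [AddCommGroup E] [Module ℝ E] {σ : PointedCone ℝ E}
    (hσ : σ.IsSimplicial) : (σ : ConvexCone ℝ E).Salient := by
  obtain ⟨s, -, hli, rfl⟩ := hσ
  obtain ⟨u, hu, hut⟩ := exists_form_of_linearIndepOn hli ∅
  intro x hx hx0 hnx
  have h1 := nonneg_of_mem_hull hu hx
  have h2 := nonneg_of_mem_hull hu hnx
  rw [map_neg] at h2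
  have h3 := mem_hull_of_form_eq_zero hu hx (by linarith)
  have h4 : s ∩ {b | u b = 0} = ∅ := by
    ext b
    simp only [Set.mem_inter_iff, Set.mem_ofPred_eq, Set.mem_empty_iff_false, iff_false, not_and]
    exact fun hb h => (hut b hb).1 h
  rw [h4] at h3
  exact hx0 (by simpa using h3)

variable (N) in
/-- A fan in the lattice `N`: a finite nonempty set of strictly convex rational polyhedral cones
that contains all faces of its members and in which any two members meet in a common face. -/
@[ext]
structure Fan where
  /-- the cones of the fan -/
  cones : Set (PointedCone ℝ (RealSpace N))
  finite : cones.Finite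
  nonempty : cones.Nonempty
  isRational : ∀ σ ∈ cones, IsRationalCone σ
  salient : ∀ σ ∈ cones, (σ : ConvexCone ℝ (RealSpace N)).Salient
  face_mem : ∀ σ ∈ cones, ∀ τ : PointedCone ℝ (RealSpace N), τ.IsFaceOf σ → τ ∈ cones
  inf_isFaceOf : ∀ σ ∈ cones, ∀ σ' ∈ cones, (σ ⊓ σ').IsFaceOf σ

namespace Fan

lemma bot_mem (Δ : Fan N) : ⊥ ∈ Δ.cones := by
  obtain ⟨σ, hσ⟩ := Δ.nonempty
  refine Δ.face_mem σ hσ ⊥ ⟨bot_le, ?_⟩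
  intro x y a hx hy ha h
  by_contra hx0
  have h1 : a • x + y = 0 := by simpa using h
  have h2 : a • x ≠ 0 := smul_ne_zero ha.ne' (by simpa using hx0)
  refine Δ.salient σ hσ (a • x) (PointedCone.smul_mem σ ha.le hx) h2 ?_
  rw [neg_eq_of_add_eq_zero_right h1]
  exact hy

/-- The support `|Δ|` of a fan, the union of its cones. -/
def support (Δ : Fan N) : Set (RealSpace N) := ⋃ σ ∈ Δ.cones, (σ : Set (RealSpace N))

/-- The cone spanned by the support of a fan. -/
def hullCone (Δ : Fan N) : PointedCone ℝ (RealSpace N) := PointedCone.hull ℝ Δ.support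

/-- As a set, `hullCone Δ` is the convex hull of the support of `Δ`. -/
lemma coe_hullCone (Δ : Fan N) : (Δ.hullCone : Set (RealSpace N)) = convexHull ℝ Δ.support :=
  coe_hull_biUnion Δ.nonempty

/-- The fan of all faces of a strictly convex rational polyhedral cone. -/
def faces (σ : PointedCone ℝ (RealSpace N)) (hr : IsRationalCone σ)
    (hs : (σ : ConvexCone ℝ (RealSpace N)).Salient) : Fan N where
  cones := {τ | τ.IsFaceOf σ}
  finite := by
    obtain ⟨B, hB, rfl⟩ := hr
    exact finite_faces (hB.image _)
  nonempty := ⟨σ, .refl σ⟩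
  isRational τ hτ := isRationalCone_of_isFaceOf hτ hr
  salient τ hτ := hs.anti (fun _ hx => hτ.le hx)
  face_mem _ hσ τ hτ := PointedCone.IsFaceOf.trans hτ hσ
  inf_isFaceOf τ hτ τ' hτ' :=
    (PointedCone.IsFaceOf.isFaceOf_iff_le (hτ.inf_left hτ') hτ).2 inf_le_left

end Fan

variable (N) in
/-- A system of fans in `N` indexed by `I`: `Δ i j = Δ j i`, and `Δ i j ∩ Δ j k` is a subfan of
`Δ i k`. (A nonempty intersection of fans is a fan, and any two fans have the zero cone in common,
so the latter only requires the inclusion of the sets of cones.) -/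
structure FanSystem (I : Type) where
  /-- the fans of the system -/
  fan : I → I → Fan N
  symm : ∀ i j, fan i j = fan j i
  inter_subset : ∀ i j k, (fan i j).cones ∩ (fan j k).cones ⊆ (fan i k).cones

variable {I : Type}

/-- A system of fans is affine if every `Δ i i` is the fan of faces of a single cone. -/
def FanSystem.IsAffine (S : FanSystem N I) : Prop :=
  ∀ i, ∃ σ : PointedCone ℝ (RealSpace N), (S.fan i i).cones = {τ | τ.IsFaceOf σ}

/-- A system of fans is simplicial if all its cones are simplicial. -/
def FanSystem.IsSimplicial (S : FanSystem N I) : Prop :=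
  ∀ i j, ∀ σ ∈ (S.fan i j).cones, σ.IsSimplicial

variable (N I) in
/-- A simplicial affine system of fans in `N`. -/
structure SimplicialAffineSystem extends FanSystem N I where
  isAffine : toFanSystem.IsAffine
  isSimplicial : toFanSystem.IsSimplicial

namespace SimplicialAffineSystem

variable (S : SimplicialAffineSystem N I)

lemma fan_subset_left (i j : I) : (S.fan i j).cones ⊆ (S.fan i i).cones := fun σ hσ =>
  S.inter_subset i j i (And.intro hσ (by rw [S.symm j i]; exact hσ))

lemma fan_subset_right (i j : I) : (S.fan i j).cones ⊆ (S.fan j j).cones := by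
  rw [S.symm i j]; exact S.fan_subset_left j i

/-- The cone `σ i i` whose faces form the fan `Δ i i`. -/
def maxCone (i : I) : PointedCone ℝ (RealSpace N) := (S.isAffine i).choose

lemma mem_fan_self_iff {i : I} {τ : PointedCone ℝ (RealSpace N)} :
    τ ∈ (S.fan i i).cones ↔ τ.IsFaceOf (S.maxCone i) := by
  rw [(S.isAffine i).choose_spec]; rfl

lemma maxCone_mem (i : I) : S.maxCone i ∈ (S.fan i i).cones :=
  S.mem_fan_self_iff.2 (.refl _)

lemma le_hullCone {i j : I} {τ : PointedCone ℝ (RealSpace N)} (hτ : τ ∈ (S.fan i j).cones) :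
    τ ≤ (S.fan i j).hullCone :=
  fun _ hx => Submodule.subset_span (Set.mem_biUnion hτ hx)

/-- The cone spanned by the support of `Δ i j` is a face of `σ i i`; its rays are the rays in
`Δ i j`. -/
lemma hullCone_eq {i j : I} {s : Set (RealSpace N)} (hsσ : PointedCone.hull ℝ s = S.maxCone i) :
    (S.fan i j).hullCone =
      PointedCone.hull ℝ (s ∩ {b | ∃ ρ ∈ (S.fan i j).cones, b ∈ ρ}) := by
  refine le_antisymm (Submodule.span_le.2 ?_) (Submodule.span_le.2 ?_)
  · intro x hx
    simp only [Fan.support, Set.mem_iUnion] at hx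
    obtain ⟨ρ, hρ, hx⟩ := hx
    have h1 := S.mem_fan_self_iff.1 (S.fan_subset_left i j hρ)
    rw [← hsσ] at h1
    have hx' : x ∈ ρ := hx
    rw [face_eq_hull_inter h1] at hx'
    refine Submodule.span_mono (Set.inter_subset_inter_right s ?_) hx'
    exact (fun b hb => Exists.intro ρ (And.intro hρ hb))
  · rintro b ⟨-, ρ, hρ, hb⟩
    exact S.le_hullCone hρ hb

lemma hullCone_mem_left (i j : I) : (S.fan i j).hullCone ∈ (S.fan i i).cones := by
  obtain ⟨s, -, hli, hsσ⟩ := S.isSimplicial i i _ (S.maxCone_mem i)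
  rw [S.mem_fan_self_iff, S.hullCone_eq hsσ, ← hsσ]
  exact hull_isFaceOf_hull hli Set.inter_subset_left

lemma hullCone_mem_right (i j : I) : (S.fan i j).hullCone ∈ (S.fan j j).cones := by
  rw [S.symm i j]; exact S.hullCone_mem_left j i

lemma hullCone_self (i : I) : (S.fan i i).hullCone = S.maxCone i := by
  refine le_antisymm (Submodule.span_le.2 ?_) (S.le_hullCone (S.maxCone_mem i))
  intro x hx
  simp only [Fan.support, Set.mem_iUnion] at hx
  obtain ⟨ρ, hρ, hx⟩ := hx
  exact (S.mem_fan_self_iff.1 hρ).le hx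

/-- A ray of `σ j j` lying on the cone spanned by the support of `Δ i j` belongs to `Δ i j`. -/
lemma ray_mem {i j : I} {s : Set (RealSpace N)} (hli : LinearIndepOn ℝ id s)
    (hsσ : PointedCone.hull ℝ s = S.maxCone i) {b : RealSpace N} (hb : b ∈ s)
    (hb' : b ∈ (S.fan i j).hullCone) : PointedCone.hull ℝ {b} ∈ (S.fan i j).cones := by
  rw [S.hullCone_eq hsσ] at hb'
  obtain ⟨-, ρ, hρ, hbρ⟩ := mem_of_mem_hull_of_linearIndepOn hli Set.inter_subset_left hb hb'
  refine (S.fan i j).face_mem ρ hρ _ ?_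
  have h1 := S.mem_fan_self_iff.1 (S.fan_subset_left i j hρ)
  have h2 := hull_isFaceOf_hull hli (Set.singleton_subset_iff.2 hb)
  rw [hsσ] at h2
  exact (PointedCone.IsFaceOf.isFaceOf_iff_le h2 h1).2
    (Submodule.span_le.2 (Set.singleton_subset_iff.2 hbρ))

/-- The system `S̃` of fans of faces of the cones `conv |Δ i j|`. -/
def reduction : SimplicialAffineSystem N I where
  fan i j := Fan.faces (S.fan i j).hullCone
    ((S.fan i i).isRational _ (S.hullCone_mem_left i j))
    ((S.fan i i).salient _ (S.hullCone_mem_left i j))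
  symm i j := by
    apply Fan.ext
    simp only [Fan.faces, S.symm i j]
  inter_subset i j k := by
    rintro τ ⟨hij, hjk⟩
    change τ.IsFaceOf _ at hij
    change τ.IsFaceOf _ at hjk
    change τ.IsFaceOf _
    obtain ⟨s, -, hli, hsσ⟩ := S.isSimplicial j j _ (S.maxCone_mem j)
    have hτj : τ.IsFaceOf (S.maxCone j) :=
      hij.trans (S.mem_fan_self_iff.1 (S.hullCone_mem_right i j))
    have hle : τ ≤ (S.fan i k).hullCone := by
      rw [← hsσ] at hτj
      rw [face_eq_hull_inter hτj]
      refine Submodule.span_le.2 ?_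
      rintro b ⟨hbs, hbτ⟩
      have h1 : PointedCone.hull ℝ {b} ∈ (S.fan i j).cones := by
        rw [S.symm i j]
        refine S.ray_mem hli hsσ hbs ?_
        rw [S.symm j i]
        exact hij.le hbτ
      have h2 := S.ray_mem hli hsσ hbs (hjk.le hbτ)
      exact S.le_hullCone (S.inter_subset i j k ⟨h1, h2⟩)
        (Submodule.subset_span (Set.mem_singleton b))
    exact (PointedCone.IsFaceOf.isFaceOf_iff_le
      (hij.trans (S.mem_fan_self_iff.1 (S.hullCone_mem_left i j)))
      (S.mem_fan_self_iff.1 (S.hullCone_mem_left i k))).2 hle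
  isAffine i := ⟨_, rfl⟩
  isSimplicial i j τ hτ :=
    isSimplicial_of_isFaceOf hτ (S.isSimplicial i i _ (S.hullCone_mem_left i j))

lemma mem_reduction_iff {i j : I} {τ : PointedCone ℝ (RealSpace N)} :
    τ ∈ (S.reduction.fan i j).cones ↔ τ.IsFaceOf (S.fan i j).hullCone := Iff.rfl

/-- `Δ i j` is contained in the corresponding fan of `S̃`. -/
lemma fan_subset_reduction (i j : I) : (S.fan i j).cones ⊆ (S.reduction.fan i j).cones := by
  intro τ hτ
  rw [mem_reduction_iff]
  exact (PointedCone.IsFaceOf.isFaceOf_iff_le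
    (S.mem_fan_self_iff.1 (S.fan_subset_left i j hτ))
    (S.mem_fan_self_iff.1 (S.hullCone_mem_left i j))).2 (S.le_hullCone hτ)

end SimplicialAffineSystem

end Fans

section Schemes

variable {N : Type} [AddCommGroup N]

/-- The coordinate ring `ℂ[M]` of the torus. -/
abbrev TorusRing (N : Type) [AddCommGroup N] : Type := AddMonoidAlgebra ℂ (Module.Dual ℤ N)

/-- The coordinate ring `ℂ[σ^∨ ∩ M]`. -/
abbrev ChartRing (σ : PointedCone ℝ (RealSpace N)) : Type := AddMonoidAlgebra ℂ (dualMonoid σ)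

/-- The base `Spec ℂ`. -/
abbrev SpecC : Scheme.{0} := Spec (.of ℂ)

/-- For `τ ⊆ σ`, the inclusion `ℂ[σ^∨ ∩ M] → ℂ[τ^∨ ∩ M]`, `χ^m ↦ χ^m`. -/
def chartRestrict {τ σ : PointedCone ℝ (RealSpace N)} (h : τ ≤ σ) :
    ChartRing σ →ₐ[ℂ] ChartRing τ :=
  AddMonoidAlgebra.mapDomainAlgHom ℂ ℂ (AddSubmonoid.inclusion (dualMonoid_anti h))

lemma chartRestrict_single {τ σ : PointedCone ℝ (RealSpace N)} (h : τ ≤ σ) (m : dualMonoid σ)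
    (a : ℂ) : chartRestrict h (.single m a) = .single ⟨m, dualMonoid_anti h m.2⟩ a := by
  simp [chartRestrict]
  rfl

/-- The coaction `ℂ[σ^∨ ∩ M] → ℂ[M] ⊗ ℂ[σ^∨ ∩ M]`, `χ^m ↦ χ^m ⊗ χ^m`. -/
def chartCoaction (σ : PointedCone ℝ (RealSpace N)) :
    ChartRing σ →ₐ[ℂ] TorusRing N ⊗[ℂ] ChartRing σ :=
  (Algebra.TensorProduct.map
    (AddMonoidAlgebra.mapDomainAlgHom ℂ ℂ (dualMonoid σ).subtype) (AlgHom.id ℂ _)).comp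
    (Bialgebra.comulAlgHom ℂ (ChartRing σ))

lemma chartCoaction_single (σ : PointedCone ℝ (RealSpace N)) (m : dualMonoid σ) :
    chartCoaction σ (.single m 1) = .single (m : Module.Dual ℤ N) 1 ⊗ₜ .single m 1 := by
  simp [chartCoaction]

/-- If `τ` is the face of `σ` cut out by `m`, then `ℂ[τ^∨ ∩ M]` is the localization of
`ℂ[σ^∨ ∩ M]` at `χ^m`. -/
lemma chartRestrict_isLocalization {τ σ : PointedCone ℝ (RealSpace N)} (h : τ ≤ σ)
    (hr : IsRationalCone σ) (m : dualMonoid σ) (hm : ∀ x ∈ σ, x ∈ τ ↔ pairing m x = 0) :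
    let _ : Algebra (ChartRing σ) (ChartRing τ) := (chartRestrict h).toRingHom.toAlgebra
    IsLocalization.Away (AddMonoidAlgebra.single m 1 : ChartRing σ) (ChartRing τ) := by
  let _ : Algebra (ChartRing σ) (ChartRing τ) := (chartRestrict h).toRingHom.toAlgebra
  have halg : ∀ x, algebraMap (ChartRing σ) (ChartRing τ) x = chartRestrict h x := fun _ => rfl
  have hneg : -(m : Module.Dual ℤ N) ∈ dualMonoid τ := by
    intro x hx
    simp [(hm x (h hx)).1 hx]
  have hpow : ∀ k : ℕ, (AddMonoidAlgebra.single m 1 : ChartRing σ) ^ k = .single (k • m) 1 := by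
    intro k; simp [AddMonoidAlgebra.single_pow]
  refine ⟨?_, ?_, ?_⟩
  · rintro ⟨_, k, rfl⟩
    simp only [map_pow]
    refine IsUnit.pow k (IsUnit.of_mul_eq_one (.single ⟨_, hneg⟩ 1) ?_)
    rw [halg, chartRestrict_single, AddMonoidAlgebra.single_mul_single]
    rw [AddMonoidAlgebra.one_def]
    congr 1
    · ext; simp
    · simp
  · intro z
    obtain ⟨k, hk⟩ : ∃ k : ℕ, ∃ x : ChartRing σ,
        z * chartRestrict h ((.single m 1) ^ k) = chartRestrict h x := by
      induction z using AddMonoidAlgebra.induction_linear with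
      | zero => exact ⟨0, 0, by simp⟩
      | add f g hf hg =>
        obtain ⟨k, x, hx⟩ := hf
        obtain ⟨l, y, hy⟩ := hg
        refine ⟨k + l, x * (.single m 1) ^ l + y * (.single m 1) ^ k, ?_⟩
        rw [map_add, map_mul, map_mul, ← hx, ← hy, pow_add, map_mul]
        ring
      | single u a =>
        obtain ⟨k, hk⟩ := exists_nsmul_add_mem_dualMonoid hr m.2 hm u.2
        refine ⟨k, .single ⟨_, hk k le_rfl⟩ a, ?_⟩
        rw [hpow, chartRestrict_single, chartRestrict_single, AddMonoidAlgebra.single_mul_single]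
        congr 1
        simp
    obtain ⟨x, hx⟩ := hk
    exact ⟨(x, ⟨_, k, rfl⟩), hx⟩
  · intro x y hxy
    refine ⟨1, ?_⟩
    have hinj : Function.Injective (chartRestrict h) := by
      apply AddMonoidAlgebra.mapDomain_injective
      exact AddSubmonoid.inclusion_injective _
    simpa using hinj hxy

lemma monoidAlgebra_algHom_ext {G A : Type} [AddMonoid G] [CommRing A] [Algebra ℂ A]
    {f g : AddMonoidAlgebra ℂ G →ₐ[ℂ] A} (h : ∀ m, f (.single m 1) = g (.single m 1)) : f = g := by
  refine DFunLike.ext _ _ fun x => ?_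
  induction x using AddMonoidAlgebra.induction_linear with
  | zero => simp
  | add x y hx hy => rw [map_add, map_add, hx, hy]
  | single m a =>
    have : (AddMonoidAlgebra.single m a : AddMonoidAlgebra ℂ G) = a • .single m 1 := by simp
    rw [this, map_smul, map_smul, h]

/-- `Spec A` as a scheme over `ℂ`, for a `ℂ`-algebra `A`. -/
abbrev specOver (A : Type) [CommRing A] [Algebra ℂ A] : Over SpecC :=
  Over.mk (Spec.map (CommRingCat.ofHom (algebraMap ℂ A)))

section

variable {A B C : Type} [CommRing A] [Algebra ℂ A] [CommRing B] [Algebra ℂ B]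
  [CommRing C] [Algebra ℂ C]

/-- The morphism of `Spec`s over `ℂ` induced by a homomorphism of `ℂ`-algebras. -/
def specOverMap (f : A →ₐ[ℂ] B) : specOver B ⟶ specOver A :=
  Over.homMk (Spec.map (CommRingCat.ofHom f.toRingHom)) (by
    simp [← Spec.map_comp, ← CommRingCat.ofHom_comp])

@[simp]
lemma specOverMap_left (f : A →ₐ[ℂ] B) :
    (specOverMap f).left = Spec.map (CommRingCat.ofHom f.toRingHom) := rfl

lemma specOverMap_comp (f : A →ₐ[ℂ] B) (g : B →ₐ[ℂ] C) :
    specOverMap g ≫ specOverMap f = specOverMap (g.comp f) := by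
  ext1
  simp only [Over.comp_left, specOverMap_left, ← Spec.map_comp, ← CommRingCat.ofHom_comp]
  rfl

lemma specOverMap_id : specOverMap (AlgHom.id ℂ A) = 𝟙 _ := by
  ext1
  simp

/-- The canonical isomorphism `Spec (A ⊗ B) → Spec A × Spec B` over `ℂ`. -/
def specTensor (A B : Type) [CommRing A] [Algebra ℂ A] [CommRing B] [Algebra ℂ B] :
    specOver (A ⊗[ℂ] B) ⟶ specOver A ⊗ specOver B :=
  lift (specOverMap Algebra.TensorProduct.includeLeft)
    (specOverMap Algebra.TensorProduct.includeRight)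

instance : IsIso (specTensor A B) := by
  have h : (specTensor A B).left = (pullbackSpecIso ℂ A B).inv := by
    rw [specTensor, Over.lift_left]
    refine pullback.hom_ext ?_ ?_
    · exact (pullback.lift_fst _ _ _).trans (pullbackSpecIso_inv_fst ℂ A B).symm
    · exact (pullback.lift_snd _ _ _).trans (pullbackSpecIso_inv_snd ℂ A B).symm
  have : IsIso ((Over.forget SpecC).map (specTensor A B)) := by
    change IsIso (specTensor A B).left
    rw [h]
    infer_instance
  exact isIso_of_reflects_iso _ (Over.forget SpecC)

end

/-- The torus `T_N = Spec ℂ[M]` of the lattice `N`, where `M = Hom(N, ℤ)`; as a group scheme over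
`ℂ` it carries the structure given by the Hopf algebra `ℂ[M]`. -/
abbrev torus (N : Type) [AddCommGroup N] : Over SpecC := specOver (TorusRing N)

instance : GrpObj (torus N) :=
  inferInstanceAs (GrpObj ((Spec (.of (TorusRing N))).asOver (Spec (.of ℂ))))

/-- The affine toric variety `X_σ = Spec ℂ[σ^∨ ∩ M]`. -/
abbrev affineChart (σ : PointedCone ℝ (RealSpace N)) : Over SpecC := specOver (ChartRing σ)

/-- The morphism `X_τ → X_σ` for `τ ⊆ σ`, an open immersion if `τ` is a face of `σ`. -/
def chartMap {τ σ : PointedCone ℝ (RealSpace N)} (h : τ ≤ σ) : affineChart τ ⟶ affineChart σ :=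
  specOverMap (chartRestrict h)

/-- The action of `T_N` on `X_σ`. -/
def chartAct (σ : PointedCone ℝ (RealSpace N)) : torus N ⊗ affineChart σ ⟶ affineChart σ :=
  inv (specTensor (TorusRing N) (ChartRing σ)) ≫ specOverMap (chartCoaction σ)

/-- The base point of `X_σ`, at which all `χ^m` take the value `1`. -/
def chartPoint (σ : PointedCone ℝ (RealSpace N)) : 𝟙_ (Over SpecC) ⟶ affineChart σ :=
  Over.homMk (Spec.map (CommRingCat.ofHom (Bialgebra.counitAlgHom ℂ (ChartRing σ)).toRingHom)) (by
    simp [← Spec.map_comp, ← CommRingCat.ofHom_comp])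

lemma chartAct_naturality {τ σ : PointedCone ℝ (RealSpace N)} (h : τ ≤ σ) :
    torus N ◁ chartMap h ≫ chartAct σ = chartAct τ ≫ chartMap h := by
  have h1 : specTensor (TorusRing N) (ChartRing τ) ≫ torus N ◁ chartMap h =
      specOverMap (Algebra.TensorProduct.map (AlgHom.id ℂ _) (chartRestrict h)) ≫
        specTensor (TorusRing N) (ChartRing σ) := by
    apply CartesianMonoidalCategory.hom_ext
    · simp only [specTensor, chartMap, Category.assoc, whiskerLeft_fst, lift_fst, specOverMap_comp]
      congr 1
      ext
      simp
    · simp only [specTensor, chartMap, Category.assoc, whiskerLeft_snd, lift_snd, lift_snd_assoc,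
        specOverMap_comp]
      congr 1
  rw [chartAct, chartAct, ← cancel_epi (specTensor (TorusRing N) (ChartRing τ)), reassoc_of% h1]
  rw [IsIso.hom_inv_id_assoc, Category.assoc, IsIso.hom_inv_id_assoc, chartMap, specOverMap_comp,
    specOverMap_comp]
  congr 1
  apply monoidAlgebra_algHom_ext
  intro m
  simp [chartCoaction_single, chartRestrict_single]


lemma chartMap_trans {ρ τ σ : PointedCone ℝ (RealSpace N)} (h : ρ ≤ τ) (h' : τ ≤ σ) :
    chartMap h ≫ chartMap h' = chartMap (h.trans h') := by
  rw [chartMap, chartMap, specOverMap_comp, chartMap]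
  congr 1
  apply monoidAlgebra_algHom_ext
  intro m
  simp [chartRestrict_single]

lemma chartMap_refl (σ : PointedCone ℝ (RealSpace N)) : chartMap (le_refl σ) = 𝟙 _ := by
  rw [chartMap, ← specOverMap_id]
  congr 1
  apply monoidAlgebra_algHom_ext
  intro m
  simp [chartRestrict_single]

lemma chartMap_isOpenImmersion {τ σ : PointedCone ℝ (RealSpace N)} (h : τ ≤ σ)
    (hr : IsRationalCone σ) (m : dualMonoid σ) (hm : ∀ x ∈ σ, x ∈ τ ↔ pairing m x = 0) :
    IsOpenImmersion (chartMap h).left := by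
  let _ : Algebra (ChartRing σ) (ChartRing τ) := (chartRestrict h).toRingHom.toAlgebra
  have := chartRestrict_isLocalization h hr m hm
  exact IsOpenImmersion.of_isLocalization (S := ChartRing τ)
    (AddMonoidAlgebra.single m 1 : ChartRing σ)

lemma chartMap_range {τ σ : PointedCone ℝ (RealSpace N)} (h : τ ≤ σ)
    (hr : IsRationalCone σ) (m : dualMonoid σ) (hm : ∀ x ∈ σ, x ∈ τ ↔ pairing m x = 0) :
    Set.range (chartMap h).left =
      (PrimeSpectrum.basicOpen (AddMonoidAlgebra.single m 1 : ChartRing σ) :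
        Set (PrimeSpectrum (ChartRing σ))) := by
  let _ : Algebra (ChartRing σ) (ChartRing τ) := (chartRestrict h).toRingHom.toAlgebra
  have := chartRestrict_isLocalization h hr m hm
  exact PrimeSpectrum.localization_away_comap_range (ChartRing τ) _

lemma chartPoint_chartMap {τ σ : PointedCone ℝ (RealSpace N)} (h : τ ≤ σ) :
    chartPoint τ ≫ chartMap h = chartPoint σ := by
  ext1
  simp only [chartPoint, chartMap, Over.comp_left, Over.homMk_left, specOverMap_left,
    ← Spec.map_comp, ← CommRingCat.ofHom_comp]
  congr 2
  have : (Bialgebra.counitAlgHom ℂ (ChartRing τ)).comp (chartRestrict h) =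
      Bialgebra.counitAlgHom ℂ (ChartRing σ) := by
    apply monoidAlgebra_algHom_ext
    intro m
    simp [chartRestrict_single]
  rw [← this]
  rfl

end Schemes

namespace SimplicialAffineSystem

variable {N : Type} [AddCommGroup N] {I : Type} (S : SimplicialAffineSystem N I)

/-- The pairs `(τ, i)` with `i ∈ I` and `τ ∈ Δ i i`, which label the charts `X_[τ, i]`. -/
@[ext]
structure Index where
  /-- the cone `τ` -/
  cone : PointedCone ℝ (RealSpace N)
  /-- the index `i` -/
  idx : I
  mem : cone ∈ (S.fan idx idx).cones

/-- `(τ, i) ≤ (σ, j)` if `τ ∈ Δ i j` and `τ` is a face of `σ`. In particular `(τ, i)` and `(τ, j)`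
are equivalent, that is, they label the same chart, exactly if `τ ∈ Δ i j`. -/
instance : Preorder S.Index where
  le p q := p.cone ≤ q.cone ∧ p.cone ∈ (S.fan p.idx q.idx).cones
  le_refl p := ⟨le_rfl, p.mem⟩
  le_trans p q r hpq hqr := by
    refine ⟨hpq.1.trans hqr.1, S.inter_subset p.idx q.idx r.idx ⟨hpq.2, ?_⟩⟩
    refine (S.fan q.idx r.idx).face_mem _ hqr.2 _ ?_
    have h1 := S.mem_fan_self_iff.1 (S.fan_subset_right _ _ hpq.2)
    have h2 := S.mem_fan_self_iff.1 q.mem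
    exact (PointedCone.IsFaceOf.isFaceOf_iff_le h1 h2).2 hpq.1

lemma isFaceOf_of_le {p q : S.Index} (h : p ≤ q) : p.cone.IsFaceOf q.cone := by
  have h1 := S.mem_fan_self_iff.1 (S.fan_subset_right _ _ h.2)
  exact (PointedCone.IsFaceOf.isFaceOf_iff_le h1 (S.mem_fan_self_iff.1 q.mem)).2 h.1

/-- The gluing diagram: `(τ, i) ↦ X_τ`, with the inclusions `X_τ → X_σ` for `(τ, i) ≤ (σ, j)`. -/
def diagram : S.Index ⥤ Scheme.{0} where
  obj p := (affineChart p.cone).left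
  map h := (chartMap (leOfHom h).1).left
  map_id p := by
    rw [chartMap_refl]; rfl
  map_comp h h' := by
    rw [← chartMap_trans (leOfHom h).1 (leOfHom h').1]; rfl

variable [Module.Free ℤ N] [Module.Finite ℤ N]

lemma exists_character {p q : S.Index} (h : p ≤ q) :
    ∃ m : dualMonoid q.cone, ∀ x ∈ q.cone, x ∈ p.cone ↔ pairing m x = 0 := by
  obtain ⟨m, hm, hm'⟩ := exists_character_of_isFaceOf (S.isFaceOf_of_le h)
    (S.isSimplicial _ _ _ q.mem) ((S.fan _ _).isRational _ q.mem)
  exact ⟨⟨m, hm⟩, hm'⟩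

instance instIsOpenImmersionMapDiagram {p q : S.Index} (f : p ⟶ q) : IsOpenImmersion (S.diagram.map f) := by
  obtain ⟨m, hm⟩ := S.exists_character (leOfHom f)
  exact chartMap_isOpenImmersion (leOfHom f).1 ((S.fan _ _).isRational _ q.mem) m hm

instance : (S.diagram ⋙ Scheme.forget).IsLocallyDirected where
  cond {p q r} f g x y hxy := by
    have hxy' : S.diagram.map f x = S.diagram.map g y := hxy
    obtain ⟨m, hm⟩ := S.exists_character (leOfHom f)
    obtain ⟨m', hm'⟩ := S.exists_character (leOfHom g)
    have hr := (S.fan _ _).isRational _ r.mem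
    have hp := S.isFaceOf_of_le (leOfHom f)
    have hq := S.isFaceOf_of_le (leOfHom g)
    have hle : p.cone ⊓ q.cone ≤ r.cone := inf_le_left.trans hp.le
    have hmm : ∀ x ∈ r.cone, x ∈ p.cone ⊓ q.cone ↔
        pairing ((m + m' : dualMonoid r.cone) : Module.Dual ℤ N) x = 0 := by
      intro x hx
      have h1 := m.2 x hx
      have h2 := m'.2 x hx
      rw [Submodule.mem_inf, hm x hx, hm' x hx, AddSubmonoid.coe_add, pairing_add,
        LinearMap.add_apply]
      constructor
      · rintro ⟨h3, h4⟩; rw [h3, h4, add_zero]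
      · intro h; constructor <;> linarith
    have hface : (p.cone ⊓ q.cone).IsFaceOf r.cone := hp.inf_left hq
    have hfp : (p.cone ⊓ q.cone).IsFaceOf p.cone :=
      (PointedCone.IsFaceOf.isFaceOf_iff_le hface hp).2 inf_le_left
    have hfq : (p.cone ⊓ q.cone).IsFaceOf q.cone :=
      (PointedCone.IsFaceOf.isFaceOf_iff_le hface hq).2 inf_le_right
    let l : S.Index := ⟨p.cone ⊓ q.cone, r.idx, (S.fan _ _).face_mem _ r.mem _ hface⟩
    have hlp : l ≤ p := ⟨inf_le_left, by
      change p.cone ⊓ q.cone ∈ (S.fan r.idx p.idx).cones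
      rw [S.symm]
      exact (S.fan _ _).face_mem _ (leOfHom f).2 _ hfp⟩
    have hlq : l ≤ q := ⟨inf_le_right, by
      change p.cone ⊓ q.cone ∈ (S.fan r.idx q.idx).cones
      rw [S.symm]
      exact (S.fan _ _).face_mem _ (leOfHom g).2 _ hfq⟩
    have hlr : l ≤ r := hlp.trans (leOfHom f)
    have hz : S.diagram.map f x ∈ Set.range (S.diagram.map (homOfLE hlr)) := by
      have h1 : Set.range (S.diagram.map f) = _ := chartMap_range (leOfHom f).1 hr m hm
      have h2 : Set.range (S.diagram.map g) = _ := chartMap_range (leOfHom g).1 hr m' hm'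
      have h3 : Set.range (S.diagram.map (homOfLE hlr)) = _ := chartMap_range hle hr (m + m') hmm
      rw [h3]
      have e : (AddMonoidAlgebra.single (m + m') 1 : ChartRing r.cone) =
          .single m 1 * .single m' 1 := by simp [AddMonoidAlgebra.single_mul_single]
      rw [e, PrimeSpectrum.basicOpen_mul]
      refine ⟨?_, ?_⟩
      · rw [← h1]; exact ⟨x, rfl⟩
      · rw [← h2, hxy']; exact ⟨y, rfl⟩
    obtain ⟨z, hz⟩ := hz
    refine ⟨l, homOfLE hlp, homOfLE hlq, z, ?_, ?_⟩
    · apply (S.diagram.map f).isOpenEmbedding.injective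
      change S.diagram.map f (S.diagram.map (homOfLE hlp) z) = S.diagram.map f x
      rw [← hz, ← Scheme.Hom.comp_apply, ← S.diagram.map_comp]
      rfl
    · apply (S.diagram.map g).isOpenEmbedding.injective
      change S.diagram.map g (S.diagram.map (homOfLE hlq) z) = S.diagram.map g y
      rw [← hxy', ← hz, ← Scheme.Hom.comp_apply, ← S.diagram.map_comp]
      rfl

/-- The structure morphisms `X_τ → Spec ℂ`. -/
def structureCocone : Cocone S.diagram where
  pt := SpecC
  ι := { app := fun p => (affineChart p.cone).hom
         naturality := fun _ _ f => (Over.w (chartMap (leOfHom f).1)).trans (Category.comp_id _).symm }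

/-- The scheme `X_S` over `ℂ`: the affine toric varieties `X_[σ i i, i]`, glued along their open
subschemes `X_(Δ i j)`. -/
def scheme : Over SpecC := Over.mk (colimit.desc S.diagram S.structureCocone)

/-- The inclusion of the chart `X_[τ, i]`. -/
def chartι (p : S.Index) : affineChart p.cone ⟶ S.scheme :=
  Over.homMk (colimit.ι S.diagram p) (colimit.ι_desc S.structureCocone p)

instance (p : S.Index) : IsOpenImmersion (S.chartι p).left :=
  inferInstanceAs (IsOpenImmersion (colimit.ι S.diagram p))

lemma chartMap_chartι {p q : S.Index} (h : p ≤ q) : chartMap h.1 ≫ S.chartι q = S.chartι p := by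
  ext1
  exact colimit.w S.diagram (homOfLE h)

/-- Two charts meet in the charts below both of them. -/
lemma chartι_eq_iff {p q : S.Index} {x : (affineChart p.cone).left}
    {y : (affineChart q.cone).left} : (S.chartι p).left x = (S.chartι q).left y ↔
      ∃ (r : S.Index) (hp : r ≤ p) (hq : r ≤ q) (z : (affineChart r.cone).left),
        (chartMap hp.1).left z = x ∧ (chartMap hq.1).left z = y := by
  refine (Scheme.IsLocallyDirected.ι_eq_ι_iff S.diagram).trans ⟨?_, ?_⟩
  · rintro ⟨r, f, g, z, h⟩; exact ⟨r, leOfHom f, leOfHom g, z, h⟩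
  · rintro ⟨r, f, g, z, h⟩; exact ⟨r, homOfLE f, homOfLE g, z, h⟩

/-- The open cover of `X_S` by its charts. -/
def cover : S.scheme.left.OpenCover := Scheme.IsLocallyDirected.openCover S.diagram

lemma exists_lift_of_pullback {p q : S.Index}
    (x : (pullback (colimit.ι S.diagram p) (colimit.ι S.diagram q)).carrier) :
    ∃ (r : S.Index) (f : r ⟶ p) (g : r ⟶ q) (z : S.diagram.obj r),
      pullback.lift (S.diagram.map f) (S.diagram.map g)
        ((colimit.w S.diagram f).trans (colimit.w S.diagram g).symm) z = x := by
  have h : colimit.ι S.diagram p (pullback.fst (colimit.ι S.diagram p) (colimit.ι S.diagram q) x) =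
      colimit.ι S.diagram q
        (pullback.snd (colimit.ι S.diagram p) (colimit.ι S.diagram q) x) := by
    rw [← Scheme.Hom.comp_apply, pullback.condition, Scheme.Hom.comp_apply]
  obtain ⟨r, f, g, z, h1, h2⟩ := (Scheme.IsLocallyDirected.ι_eq_ι_iff S.diagram).1 h
  refine ⟨r, f, g, z, ?_⟩
  apply (pullback.fst (colimit.ι S.diagram p) (colimit.ι S.diagram q)).isOpenEmbedding.injective
  rw [← h1, ← Scheme.Hom.comp_apply, pullback.lift_fst]

instance : Category S.cover.I₀ := inferInstanceAs (Category S.Index)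

instance : S.cover.LocallyDirected where
  trans f := S.diagram.map f
  trans_id p := S.diagram.map_id p
  trans_comp f g := S.diagram.map_comp f g
  w f := colimit.w S.diagram f
  directed {p q} x := S.exists_lift_of_pullback (p := p) (q := q) x
  property_trans {p q} f := instIsOpenImmersionMapDiagram S (p := p) (q := q) f

/-- The induced open cover of `T × X_S`. -/
def torusCover : (torus N ⊗ S.scheme).left.OpenCover :=
  S.cover.pullback₁ (snd (torus N) S.scheme).left

instance : Category S.torusCover.I₀ := inferInstanceAs (Category S.Index)

instance : S.torusCover.LocallyDirected :=
  Scheme.Cover.locallyDirectedPullbackCover S.cover (snd (torus N) S.scheme).left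

/-- The part of `T × X_S` over the chart `p`. -/
abbrev piece (p : S.Index) : Scheme.{0} := pullback (snd (torus N) S.scheme).left (S.chartι p).left

lemma toProd_condition (p : S.Index) :
    (pullback.fst (snd (torus N) S.scheme).left (S.chartι p).left ≫
      (fst (torus N) S.scheme).left) ≫ (torus N).hom =
    pullback.snd (snd (torus N) S.scheme).left (S.chartι p).left ≫ (affineChart p.cone).hom := by
  rw [← Over.w (S.chartι p), ← Category.assoc _ _ S.scheme.hom, ← pullback.condition,
    Category.assoc, Category.assoc]
  congr 1
  exact pullback.condition

/-- The part of `T × X_S` over a chart is the product of `T` with that chart. -/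
def toProd (p : S.Index) : S.piece p ⟶ (torus N ⊗ affineChart p.cone).left :=
  pullback.lift (pullback.fst (snd (torus N) S.scheme).left (S.chartι p).left ≫
    (fst (torus N) S.scheme).left) (pullback.snd (snd (torus N) S.scheme).left (S.chartι p).left)
    (S.toProd_condition p)

lemma toProd_fst (p : S.Index) : S.toProd p ≫ (fst (torus N) (affineChart p.cone)).left =
    pullback.fst (snd (torus N) S.scheme).left (S.chartι p).left ≫ (fst (torus N) S.scheme).left :=
  pullback.lift_fst _ _ _

lemma toProd_snd (p : S.Index) : S.toProd p ≫ (snd (torus N) (affineChart p.cone)).left =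
    pullback.snd (snd (torus N) S.scheme).left (S.chartι p).left :=
  pullback.lift_snd _ _ _

lemma toProd_compat {p q : S.Index} (f : p ⟶ q) (t : S.piece p ⟶ S.piece q)
    (h1 : t ≫ pullback.fst _ _ = pullback.fst _ _)
    (h2 : t ≫ pullback.snd _ _ = pullback.snd _ _ ≫ (chartMap (leOfHom f).1).left) :
    t ≫ S.toProd q ≫ (chartAct q.cone ≫ S.chartι q).left =
      S.toProd p ≫ (chartAct p.cone ≫ S.chartι p).left := by
  have h : t ≫ S.toProd q = S.toProd p ≫ (torus N ◁ chartMap (leOfHom f).1).left := by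
    apply Over.tensorObj_ext
    · change (t ≫ S.toProd q) ≫ (fst (torus N) (affineChart q.cone)).left =
        (_ ≫ _) ≫ (fst (torus N) (affineChart q.cone)).left
      rw [Category.assoc, Category.assoc, ← Over.comp_left, whiskerLeft_fst, toProd_fst,
        toProd_fst, ← Category.assoc, h1]
    · change (t ≫ S.toProd q) ≫ (snd (torus N) (affineChart q.cone)).left =
        (_ ≫ _) ≫ (snd (torus N) (affineChart q.cone)).left
      rw [Category.assoc, Category.assoc, ← Over.comp_left, whiskerLeft_snd, toProd_snd, h2,
        Over.comp_left, ← Category.assoc, toProd_snd]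
  rw [← Category.assoc, h, Category.assoc, ← Over.comp_left, ← Category.assoc (torus N ◁ _),
    chartAct_naturality, Category.assoc, S.chartMap_chartι (leOfHom f)]

lemma toProd_over (p : S.Index) : (S.toProd p ≫ (chartAct p.cone ≫ S.chartι p).left) ≫
    S.scheme.hom =
    pullback.fst (snd (torus N) S.scheme).left (S.chartι p).left ≫ (torus N ⊗ S.scheme).hom := by
  rw [Category.assoc, Over.w, ← Over.w (fst (torus N) (affineChart p.cone)), ← Category.assoc,
    toProd_fst, ← Over.w (fst (torus N) S.scheme), Category.assoc]

lemma act_compat {p q : S.torusCover.I₀} (f : p ⟶ q) :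
    Scheme.Cover.trans S.torusCover f ≫ S.toProd q ≫ (chartAct q.cone ≫ S.chartι q).left =
      S.toProd p ≫ (chartAct p.cone ≫ S.chartι p).left :=
  S.toProd_compat (p := p) (q := q) f (Scheme.Cover.trans S.torusCover f)
    (Scheme.Cover.trans_map S.torusCover f) (pullback.lift_snd _ _ _)

/-- The action of the torus on `X_S`, glued from the actions on the charts. -/
def act : torus N ⊗ S.scheme ⟶ S.scheme :=
  Scheme.OpenCover.glueMorphismsOverOfLocallyDirected (X := torus N ⊗ S.scheme) S.torusCover
    (fun p => S.toProd p ≫ (chartAct p.cone ≫ S.chartι p).left)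
    S.act_compat
    (fun p => S.toProd_over p)

lemma fst_act (p : S.Index) :
    pullback.fst (snd (torus N) S.scheme).left (S.chartι p).left ≫ S.act.left =
      S.toProd p ≫ (chartAct p.cone ≫ S.chartι p).left :=
  Scheme.OpenCover.map_glueMorphismsOverOfLocallyDirected_left (X := torus N ⊗ S.scheme)
    S.torusCover
    (fun p => S.toProd p ≫ (chartAct p.cone ≫ S.chartι p).left) S.act_compat
    (fun p => S.toProd_over p) p

/-- The action on `X_S` restricts to the standard action on each chart. -/
lemma whiskerLeft_chartι_act (p : S.Index) :
    torus N ◁ S.chartι p ≫ S.act = chartAct p.cone ≫ S.chartι p := by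
  ext1
  have hcond : (torus N ◁ S.chartι p).left ≫ (snd (torus N) S.scheme).left =
      (snd (torus N) (affineChart p.cone)).left ≫ (S.chartι p).left := by
    rw [← Over.comp_left, whiskerLeft_snd, Over.comp_left]
  let t : (torus N ⊗ affineChart p.cone).left ⟶ S.piece p :=
    pullback.lift _ _ hcond
  have ht1 : t ≫ pullback.fst (snd (torus N) S.scheme).left (S.chartι p).left =
    (torus N ◁ S.chartι p).left := pullback.lift_fst _ _ hcond
  have ht2 : t ≫ pullback.snd (snd (torus N) S.scheme).left (S.chartι p).left =
    (snd (torus N) (affineChart p.cone)).left := pullback.lift_snd _ _ hcond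
  have hid : t ≫ S.toProd p = 𝟙 _ := by
    apply Over.tensorObj_ext
    · change (t ≫ S.toProd p) ≫ (fst (torus N) (affineChart p.cone)).left =
        𝟙 _ ≫ (fst (torus N) (affineChart p.cone)).left
      rw [Category.assoc, toProd_fst, ← Category.assoc, ht1, ← Over.comp_left, whiskerLeft_fst,
        Category.id_comp]
    · change (t ≫ S.toProd p) ≫ (snd (torus N) (affineChart p.cone)).left =
        𝟙 _ ≫ (snd (torus N) (affineChart p.cone)).left
      rw [Category.assoc, toProd_snd, ht2, Category.id_comp]
  rw [Over.comp_left, ← ht1, Category.assoc, fst_act, ← Category.assoc, hid, Category.id_comp]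

end SimplicialAffineSystem

/-! ### Toric prevarieties and toric morphisms -/

/-- The data underlying a toric prevariety: a scheme over `ℂ` with a distinguished complex point
`base` and a morphism `act : T_N × X → X`, where `T_N` is the torus of the lattice `N`. The axioms
are stated in `IsToricPrevariety`. -/
structure TorusScheme (N : Type) [AddCommGroup N] where
  /-- the underlying scheme over `ℂ` -/
  X : Over SpecC
  /-- the action morphism -/
  act : torus N ⊗ X ⟶ X
  /-- the base point -/
  base : 𝟙_ (Over SpecC) ⟶ X

namespace TorusScheme

variable {N N' : Type} [AddCommGroup N] [AddCommGroup N']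

/-- The orbit map `T_N → X`, `t ↦ t • x₀`, of the base point. -/
def orbitMap (Y : TorusScheme N) : torus N ⟶ Y.X :=
  (ρ_ (torus N)).inv ≫ torus N ◁ Y.base ≫ Y.act

/-- An open subset `U` is `T_N`-stable if the action maps `T_N × U` into `U`. -/
def IsStable (Y : TorusScheme N) (U : Y.X.left.Opens) : Prop :=
  (snd (torus N) Y.X).left ⁻¹ᵁ U ≤ Y.act.left ⁻¹ᵁ U

/-- The `T_N`-stable affine charts: the `T_N`-stable open affine subschemes. -/
def IsChart (Y : TorusScheme N) (U : Y.X.left.Opens) : Prop :=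
  IsAffineOpen U ∧ Y.IsStable U

/-- `Y` is a toric prevariety: an integral normal scheme of finite type over `ℂ`, not necessarily
separated, with an action of `T_N` for which the orbit map of the base point is an open embedding
of `T_N`, and with an atlas of `T_N`-stable affine charts. -/
structure IsToricPrevariety (Y : TorusScheme N) : Prop where
  isIntegral : IsIntegral Y.X.left
  locallyOfFiniteType : LocallyOfFiniteType Y.X.hom
  quasiCompact : QuasiCompact Y.X.hom
  isNormal : ∀ x : Y.X.left, IsIntegrallyClosed (Y.X.left.presheaf.stalk x)
  one_act : MonObj.one (X := torus N) ▷ Y.X ≫ Y.act = (λ_ Y.X).hom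
  mul_act : MonObj.mul (X := torus N) ▷ Y.X ≫ Y.act =
    (α_ (torus N) (torus N) Y.X).hom ≫ torus N ◁ Y.act ≫ Y.act
  isOpenImmersion_orbitMap : IsOpenImmersion Y.orbitMap.left
  exists_chart : ∀ x : Y.X.left, ∃ U : Y.X.left.Opens, x ∈ U ∧ Y.IsChart U

/-- `Y` is of affine intersection: any two maximal `T_N`-stable affine charts meet in an affine
open subscheme. -/
def IsOfAffineIntersection (Y : TorusScheme N) : Prop :=
  ∀ U U' : Y.X.left.Opens, Maximal Y.IsChart U → Maximal Y.IsChart U' → IsAffineOpen (U ⊓ U')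

/-- `f` is a toric morphism: it maps base point to base point and is equivariant with respect to a
homomorphism of the acting tori. -/
def IsToricMorphism (Y : TorusScheme N) (Y' : TorusScheme N') (f : Y.X ⟶ Y'.X) : Prop :=
  Y.base ≫ f = Y'.base ∧
    ∃ φ : torus N ⟶ torus N', IsMonHom φ ∧ Y.act ≫ f = (φ ⊗ₘ f) ≫ Y'.act

end TorusScheme

namespace SimplicialAffineSystem

variable {N : Type} [AddCommGroup N] [Module.Free ℤ N] [Module.Finite ℤ N]
  {I : Type} (S : SimplicialAffineSystem N I)

/-- The label of the chart `X_[σ i i, i]` of `X_S`. -/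
def maxIndex (i : I) : S.Index := ⟨S.maxCone i, i, S.maxCone_mem i⟩

/-- The chart `X_[τ, i]` as an open subscheme of `X_S`. -/
def chart (p : S.Index) : S.scheme.left.Opens := (S.chartι p).left.opensRange

/-- `X_S` with its torus action and base point. (The choice of `i ∈ I` does not matter, see
`base_eq`.) -/
def toricPrevariety [Nonempty I] : TorusScheme N where
  X := S.scheme
  act := S.act
  base := chartPoint _ ≫ S.chartι (S.maxIndex (Classical.arbitrary I))

/-- The base point of `X_S` is the base point of every chart. -/
lemma base_eq [Nonempty I] (p : S.Index) :
    S.toricPrevariety.base = chartPoint p.cone ≫ S.chartι p := by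
  let q := S.maxIndex (Classical.arbitrary I)
  let o : S.Index := ⟨⊥, p.idx, Fan.bot_mem _⟩
  have hp : o ≤ p := ⟨bot_le, Fan.bot_mem _⟩
  have hq : o ≤ q := ⟨bot_le, Fan.bot_mem _⟩
  change chartPoint q.cone ≫ S.chartι q = _
  rw [← chartPoint_chartMap hp.1, ← chartPoint_chartMap hq.1, Category.assoc, Category.assoc,
    S.chartMap_chartι hp, S.chartMap_chartι hq]

/-- The label `[τ, i]`, regarded as the label of a chart of `X_S̃`. -/
def reductionIndex (p : S.Index) : S.reduction.Index :=
  ⟨p.cone, p.idx, S.fan_subset_reduction _ _ p.mem⟩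

/-- The morphisms `X_[τ, i] → X_S̃` onto the charts of `X_S̃` with the same labels. -/
def reductionCocone : Cocone S.diagram where
  pt := S.reduction.scheme.left
  ι := { app := fun p => (S.reduction.chartι (S.reductionIndex p)).left
         naturality := fun p q f => by
          have h : S.reductionIndex p ≤ S.reductionIndex q :=
            ⟨(leOfHom f).1, S.fan_subset_reduction _ _ (leOfHom f).2⟩
          exact (congrArg CommaMorphism.left (S.reduction.chartMap_chartι h)).trans
            (Category.comp_id _).symm }

/-- The morphism `g : X_S → X_S̃` associated to the identity maps of `N` and of `I`: it maps each
chart `X_[τ, i]` of `X_S` identically to the chart `X_[τ, i]` of `X_S̃`. -/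
def reductionMap : S.scheme ⟶ S.reduction.scheme :=
  Over.homMk (colimit.desc S.diagram S.reductionCocone) (colimit.hom_ext fun p =>
    (colimit.ι_desc_assoc S.reductionCocone p S.reduction.scheme.hom).trans
      ((Over.w (S.reduction.chartι (S.reductionIndex p))).trans (Over.w (S.chartι p)).symm))

lemma chartι_reductionMap (p : S.Index) :
    S.chartι p ≫ S.reductionMap = S.reduction.chartι (S.reductionIndex p) := by
  ext1
  exact colimit.ι_desc S.reductionCocone p

/-- The label of the chart `X_[σ̃ i j, j]` of `X_S`, where `σ̃ i j = conv |Δ i j|`. -/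
def hullIndex (i j : I) : S.Index := ⟨(S.fan i j).hullCone, j, S.hullCone_mem_right i j⟩

/-- The label of the chart `X_[σ̃ i i, i]` of `X_S̃`. -/
def reductionMaxIndex (i : I) : S.reduction.Index :=
  ⟨(S.fan i i).hullCone, i, PointedCone.IsFaceOf.refl _⟩

end SimplicialAffineSystem

end ToricPrevarieties

end

open ToricPrevarieties ToricPrevarieties.TorusScheme

/-!
Everything is reduced to charts and to one statement on torus actions.

`X_S` is a toric prevariety since its charts are: the ring `ℂ[σ^∨ ∩ M]` is of finite type by
Gordan's lemma (`fg_dualMonoid`), it is a domain since `M` is torsion free, and it is integrally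
closed because an element of `ℂ[M]` that is integral over it has nonnegative order along each of the
half spaces that define `σ^∨` (`isIntegrallyClosed_of_halfspaces`). Each nonempty open set meets the
torus, so `X_S` is integral. This applies to `X_S̃`, too.

The statement on torus actions is `TorusScheme.IsToricPrevariety.exists_le_of_le_iSup`: a covering
of a stable affine chart `U` by stable open subsets has a member that contains `U`. The classical
reason is that `U` has a unique closed orbit. The proof avoids orbits. By density of the torus the
ring `B` of functions on `U` is a subring of `ℂ[M]`, and the coefficient of `χ^0` is a linear form
on `B` that takes the value `1` at `1` and vanishes on the vanishing ideal of each nonempty stable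
closed subset (`exists_constCoeff`). If no member contained `U`, the complements would be
nonempty, and the vanishing ideals of these, whose sum is `B`, would all lie in the kernel of the
linear form.

It has two consequences. First, the maximal stable affine charts of `X_S̃` are among the
`X_[σ̃ i i, i]`. Any two of these meet in the single chart `X_[σ̃ i j, i]`, so `X_S̃` is of affine
intersection. Second, a toric morphism `f : X_S → Y` maps each `X_[σ i i, i]` into some maximal
stable affine chart `V i` of `Y`. If `Y` is of affine intersection, then `V i ∩ V j` is affine.
For each `τ` in `Δ i j`, the morphism `f` gives rise to a homomorphism from the ring of functions on
`V i ∩ V j` to `ℂ[τ^∨ ∩ M]`. All these agree as homomorphisms to `ℂ[M]`, so that the values lie in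
the intersection of the rings `ℂ[τ^∨ ∩ M]`, which is `ℂ[σ̃ i j^∨ ∩ M]`. Hence `f` agrees on the
charts `X_[σ̃ i j, i]` and `X_[σ̃ i j, j]` of `X_S` (`chartι_leftHullIndex_comp`), which is the
condition for `f` to factor through the gluing `X_S̃`. The remaining claims are read off from the
charts, since each chart of `X_S̃` factors through `X_S` (`chartι_ofReductionIndex`).
-/

namespace ToricPrevarieties

/-! ### Normality of affine toric varieties -/

section MonoidAlgebra

variable {R G : Type*} [CommRing R] [AddCommGroup G]

/-- The grading of `R[G]` by a homomorphism `v : G → ℤ`, recorded as the ring homomorphism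
`χ^m ↦ χ^m t^(v m)` into the Laurent series over `R[G]`. -/
noncomputable def gradingHom (v : G →+ ℤ) :
    AddMonoidAlgebra R G →+* HahnSeries ℤ (AddMonoidAlgebra R G) :=
  AddMonoidAlgebra.liftNCRingHom
    ((HahnSeries.C (Γ := ℤ)).comp (algebraMap R (AddMonoidAlgebra R G)))
    { toFun := fun m => HahnSeries.single (v m.toAdd) (.single m.toAdd 1)
      map_one' := by simp; rfl
      map_mul' := fun a b => by
        simp [HahnSeries.single_mul_single, AddMonoidAlgebra.single_mul_single] }
    (fun _ _ => .all _ _)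

lemma gradingHom_single (v : G →+ ℤ) (m : G) (r : R) :
    gradingHom v (.single m r) = HahnSeries.single (v m) (.single m r) := by
  simp [gradingHom, HahnSeries.C_apply, HahnSeries.single_mul_single,
    AddMonoidAlgebra.single_mul_single]

lemma coeff_gradingHom (v : G →+ ℤ) (x : AddMonoidAlgebra R G) (n : ℤ) (m : G) :
    ((gradingHom v x).coeff n).coeff m = if n = v m then x.coeff m else 0 := by
  classical
  induction x using AddMonoidAlgebra.induction_linear with
  | zero => simp
  | add x y hx hy => rw [map_add]; simp [hx, hy]; split_ifs <;> simp
  | single a r =>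
    rw [gradingHom_single, HahnSeries.coeff_single]
    by_cases h2 : a = m
    · subst h2
      by_cases h : n = v a <;> simp [h]
    · by_cases h : n = v a <;> simp [h2, h]

/-- If `R[G]` is an integrally closed domain and `P ⊆ G` is an intersection of half spaces, then
`R[P]` is integrally closed. An integral element of `Frac R[P]` lies in `R[G]`, and for every half
space its lowest term with respect to the corresponding grading has nonnegative degree. -/
lemma isIntegrallyClosed_of_halfspaces [IsDomain (AddMonoidAlgebra R G)]
    [IsIntegrallyClosed (AddMonoidAlgebra R G)] (P : AddSubmonoid G) (V : Set (G →+ ℤ))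
    (hP : ∀ m, m ∈ P ↔ ∀ v ∈ V, 0 ≤ v m) : IsIntegrallyClosed (AddMonoidAlgebra R P) := by
  let φ : AddMonoidAlgebra R P →+* AddMonoidAlgebra R G :=
    AddMonoidAlgebra.mapDomainRingHom R P.subtype
  let _ : Algebra (AddMonoidAlgebra R P) (AddMonoidAlgebra R G) := φ.toAlgebra
  have hinj : Function.Injective φ :=
    AddMonoidAlgebra.mapDomain_injective Subtype.val_injective
  have : FaithfulSMul (AddMonoidAlgebra R P) (AddMonoidAlgebra R G) :=
    (faithfulSMul_iff_algebraMap_injective _ _).2 hinj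
  suffices IsIntegrallyClosedIn (AddMonoidAlgebra R P) (AddMonoidAlgebra R G) from
    .of_isIntegrallyClosed_of_isIntegrallyClosedIn _ (AddMonoidAlgebra R G)
  refine isIntegrallyClosedIn_iff.2 ⟨hinj, fun {x} hx => ?_⟩
  have hsupp : ∀ m ∈ x.coeff.support, m ∈ P := by
    intro m hm
    rw [hP]
    intro v hv
    -- the order with respect to `v` is a valuation that is nonnegative on `R[P]`, hence on `x`
    let w := AddValuation.toValuation (HahnSeries.addVal ℤ (AddMonoidAlgebra R G))
    have hw : ∀ y, w y ≤ 1 ↔ 0 ≤ y.orderTop := fun y => by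
      rw [AddValuation.toValuation_apply, HahnSeries.addVal_apply]
      exact Iff.rfl
    have hmem : ∀ y : AddMonoidAlgebra R P, gradingHom v (φ y) ∈ w.integer := by
      intro y
      rw [Valuation.mem_integer_iff, hw, HahnSeries.le_orderTop_iff_forall]
      intro j hj
      ext a
      rw [coeff_gradingHom]
      split_ifs with h
      · by_contra h2
        subst h
        have h3 : a ∈ Set.range (P.subtype) := by
          by_contra h3
          exact h2 (Finsupp.mapDomain_of_notMem_range _ _ h3)
        obtain ⟨b, rfl⟩ := h3
        exact absurd ((hP _).1 b.2 v hv) (by simpa using hj)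
      · rfl
    have hint : IsIntegral w.integer (gradingHom v x) := by
      refine IsIntegral.map_of_comp_eq
        (((gradingHom v).comp φ).codRestrict w.integer hmem) (gradingHom v) ?_ hx
      ext <;> rfl
    have h1 := (Valuation.integer.integers w).mem_of_integral hint
    rw [Valuation.mem_integer_iff, hw, HahnSeries.le_orderTop_iff_forall] at h1
    by_contra! h2
    have h3 := coeff_gradingHom v x (v m) m
    rw [h1 _ (by exact_mod_cast h2)] at h3
    simp at h3
    exact Finsupp.mem_support_iff.1 hm h3.symm
  refine ⟨.ofCoeff (x.coeff.comapDomain Subtype.val Subtype.val_injective.injOn), ?_⟩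
  ext1
  exact Finsupp.mapDomain_comapDomain _ Subtype.val_injective _
    (fun m hm => ⟨⟨m, hsupp m hm⟩, rfl⟩)

/-- Laurent polynomials in `n` variables are iterated Laurent polynomials in one variable, and those
are a localization of the polynomials in one variable. -/
lemma isIntegrallyClosed_addMonoidAlgebra_pi (n : ℕ) :
    ∀ (R : Type) [CommRing R] [IsDomain R] [IsIntegrallyClosed R],
      IsIntegrallyClosed (AddMonoidAlgebra R (Fin n → ℤ)) := by
  induction n with
  | zero =>
    intro R _ _ hR
    exact hR.of_equiv (AddMonoidAlgebra.uniqueRingEquiv (Fin 0 → ℤ)).symm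
  | succ n ih =>
    intro R _ _ _
    have : IsIntegrallyClosed (LaurentPolynomial R) :=
      isIntegrallyClosed_of_isLocalization (LaurentPolynomial R)
        (Submonoid.powers (Polynomial.X : Polynomial R))
        (powers_le_nonZeroDivisors_of_noZeroDivisors Polynomial.X_ne_zero)
    have : IsIntegrallyClosed (AddMonoidAlgebra R ℤ) := this
    have h := ih (AddMonoidAlgebra R ℤ)
    let e : (Fin n → ℤ) × ℤ ≃+ (Fin (n + 1) → ℤ) :=
      AddEquiv.prodComm.trans (Fin.consLinearEquiv ℤ (fun _ => ℤ)).toAddEquiv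
    exact (h.of_equiv AddMonoidAlgebra.curryRingEquiv.symm).of_equiv
      (AddMonoidAlgebra.mapDomainRingEquiv R e)

end MonoidAlgebra

/-! ### Gordan's lemma -/

section ChartRing

variable {N : Type} [AddCommGroup N]

instance : IsAddTorsionFree (Module.Dual ℤ N) := .of_isTorsionFree ℤ _

variable [Module.Free ℤ N] [Module.Finite ℤ N]

/-- **Gordan's lemma**: the characters that are nonnegative on a rational cone form a finitely
generated monoid. With slack variables for the values on the generators of the cone, they are the
image of the set of solutions in nonnegative integers of a system of linear equations. -/
lemma fg_dualMonoid {σ : PointedCone ℝ (RealSpace N)} (hσ : IsRationalCone σ) :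
    AddMonoid.FG (dualMonoid σ) := by
  classical
  obtain ⟨B, hB, rfl⟩ := hσ
  have := hB.fintype
  let e := Module.Free.chooseBasis ℤ (Module.Dual ℤ N)
  let J := Module.Free.ChooseBasisIndex ℤ (Module.Dual ℤ N)
  let c : J ⊕ J ⊕ B → Module.Dual ℤ N := Sum.elim e (Sum.elim (-e) 0)
  let L : (J ⊕ J ⊕ B → ℕ) →+ Module.Dual ℤ N :=
    ∑ i, (multiplesHom _ (c i)).comp (Pi.evalAddMonoidHom _ i)
  have hL : ∀ x, L x = ∑ i, x i • c i := fun x => by simp [L]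
  let f : (J ⊕ J ⊕ B → ℕ) →+ (B → ℤ) :=
    { toFun := fun x b => L x b
      map_zero' := by ext; simp
      map_add' := fun x y => by ext; simp }
  let g : (J ⊕ J ⊕ B → ℕ) →+ (B → ℤ) :=
    { toFun := fun x b => x (.inr (.inr b))
      map_zero' := by ext; simp
      map_add' := fun x y => by ext; simp }
  have key : (f.eqLocusM g).map L = dualMonoid (PointedCone.hull ℝ ((fun v : N =>
      (1 : ℝ) ⊗ₜ[ℤ] v) '' B)) := by
    ext m
    constructor
    · rintro ⟨x, hx, rfl⟩ y hy
      refine nonneg_of_mem_hull ?_ hy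
      rintro _ ⟨b, hb, rfl⟩
      have h1 : L x b = x (.inr (.inr ⟨b, hb⟩)) := congrFun hx ⟨b, hb⟩
      rw [pairing_one_tmul, h1]
      positivity
    · intro hm
      have hmb : ∀ b ∈ B, 0 ≤ m b := fun b hb => by
        have := hm _ (Submodule.subset_span ⟨b, hb, rfl⟩)
        rw [pairing_one_tmul] at this
        exact_mod_cast this
      let x : J ⊕ J ⊕ B → ℕ := Sum.elim (fun j => (e.repr m j).toNat)
        (Sum.elim (fun j => (-e.repr m j).toNat) fun b => (m b).toNat)
      have hx : L x = m := by
        rw [hL, Fintype.sum_sum_type, Fintype.sum_sum_type]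
        conv_rhs => rw [← e.sum_repr m]
        simp only [x, c, Sum.elim_inl, Sum.elim_inr, Pi.zero_apply, smul_zero,
          Finset.sum_const_zero, add_zero, ← Finset.sum_add_distrib, Pi.neg_apply]
        refine Finset.sum_congr rfl fun j _ => ?_
        rw [← natCast_zsmul, ← natCast_zsmul, smul_neg, ← sub_eq_add_neg, ← sub_smul]
        congr 1
        omega
      refine ⟨x, ?_, hx⟩
      ext b
      change L x b = _
      rw [hx]
      exact (Int.toNat_of_nonneg (hmb b b.2)).symm
  rw [AddMonoid.fg_iff_addSubmonoid_fg, ← key]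
  exact (AddSubmonoid.fg_eqLocusM f g).map L

lemma finiteType_chartRing {σ : PointedCone ℝ (RealSpace N)} (hσ : IsRationalCone σ) :
    Algebra.FiniteType ℂ (ChartRing σ) := by
  have := fg_dualMonoid hσ
  infer_instance

/-! ### Coordinate rings are normal domains -/

/-- As in every torsion-free abelian group. This is the property of `M` from which it follows that
`K[M]` has no zero divisors, for domains `K`. -/
instance : TwoUniqueSums (Module.Dual ℤ N) := by
  have : AddMonoid.FG (Module.Dual ℤ N) := by
    rw [← AddGroup.fg_iff_addMonoid_fg]
    exact Module.Finite.iff_addGroup_fg.1 inferInstance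
  infer_instance

instance (σ : PointedCone ℝ (RealSpace N)) : TwoUniqueSums (dualMonoid σ) :=
  .of_injective_addHom (dualMonoid σ).subtype.toAddHom Subtype.val_injective inferInstance

instance (σ : PointedCone ℝ (RealSpace N)) : IsDomain (ChartRing σ) :=
  NoZeroDivisors.to_isDomain _

instance : IsDomain (TorusRing N) := NoZeroDivisors.to_isDomain _

instance (K : Type) [CommRing K] [IsDomain K] [Algebra ℂ K] : IsDomain (K ⊗[ℂ] TorusRing N) :=
  have : IsDomain (AddMonoidAlgebra K (Module.Dual ℤ N)) := NoZeroDivisors.to_isDomain _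
  (AddMonoidAlgebra.scalarTensorEquiv ℂ K (M := Module.Dual ℤ N)).toMulEquiv.isDomain _

instance (K : Type) [CommRing K] [IsDomain K] [Algebra ℂ K] : IsDomain (TorusRing N ⊗[ℂ] K) :=
  (Algebra.TensorProduct.comm ℂ (TorusRing N) K).toMulEquiv.isDomain _

instance : IsIntegrallyClosed (TorusRing N) :=
  (isIntegrallyClosed_addMonoidAlgebra_pi _ ℂ).of_equiv
    (AddMonoidAlgebra.mapDomainRingEquiv ℂ
      (Module.finBasis ℤ (Module.Dual ℤ N)).equivFun.symm.toAddEquiv)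

/-- Affine toric varieties are normal: `σ^∨ ∩ M` is an intersection of half spaces. -/
lemma isIntegrallyClosed_chartRing {σ : PointedCone ℝ (RealSpace N)} (hσ : IsRationalCone σ) :
    IsIntegrallyClosed (ChartRing σ) := by
  obtain ⟨B, -, rfl⟩ := hσ
  refine isIntegrallyClosed_of_halfspaces _
    ((fun b : N => (LinearMap.applyₗ b : Module.Dual ℤ N →ₗ[ℤ] ℤ).toAddMonoidHom) '' B)
    fun m => ⟨?_, fun h x hx => nonneg_of_mem_hull ?_ hx⟩
  · rintro hm _ ⟨b, hb, rfl⟩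
    have := hm _ (Submodule.subset_span ⟨b, hb, rfl⟩)
    rw [pairing_one_tmul] at this
    exact_mod_cast this
  · rintro _ ⟨b, hb, rfl⟩
    rw [pairing_one_tmul]
    exact_mod_cast h _ ⟨b, hb, rfl⟩

end ChartRing

/-! ### The torus action on affine charts and on `X_S` -/

section Points

variable {A B C : Type} [CommRing A] [Algebra ℂ A] [CommRing B] [Algebra ℂ B]
  [CommRing C] [Algebra ℂ C] {N : Type} [AddCommGroup N]

lemma lift_specOverMap (a : A →ₐ[ℂ] C) (b : B →ₐ[ℂ] C) :
    lift (specOverMap a) (specOverMap b) =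
      specOverMap (Algebra.TensorProduct.productMap a b) ≫ specTensor A B := by
  apply CartesianMonoidalCategory.hom_ext
  · rw [lift_fst, Category.assoc, specTensor, lift_fst, specOverMap_comp,
      Algebra.TensorProduct.productMap_left]
  · rw [lift_snd, Category.assoc, specTensor, lift_snd, specOverMap_comp,
      Algebra.TensorProduct.productMap_right]

/-- The action on `X_σ` in terms of points with values in an algebra. -/
lemma lift_chartAct {σ : PointedCone ℝ (RealSpace N)} (a : TorusRing N →ₐ[ℂ] C)
    (b : ChartRing σ →ₐ[ℂ] C) :
    lift (specOverMap a) (specOverMap b) ≫ chartAct σ =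
      specOverMap ((Algebra.TensorProduct.productMap a b).comp (chartCoaction σ)) := by
  rw [lift_specOverMap, chartAct, Category.assoc, IsIso.hom_inv_id_assoc, specOverMap_comp]

lemma specTensor_left : (specTensor A B).left = (pullbackSpecIso ℂ A B).inv := by
  rw [specTensor, Over.lift_left]
  refine pullback.hom_ext ?_ ?_
  · exact (pullback.lift_fst _ _ _).trans (pullbackSpecIso_inv_fst ℂ A B).symm
  · exact (pullback.lift_snd _ _ _).trans (pullbackSpecIso_inv_snd ℂ A B).symm

/-- The multiplication of the torus in terms of points with values in an algebra. -/
lemma lift_mul_torus (a b : TorusRing N →ₐ[ℂ] C) :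
    lift (specOverMap a) (specOverMap b) ≫ MonObj.mul (X := torus N) =
      specOverMap ((Algebra.TensorProduct.productMap a b).comp
        (Bialgebra.comulAlgHom ℂ (TorusRing N))) := by
  rw [lift_specOverMap, Category.assoc, ← specOverMap_comp]
  congr 1
  ext1
  rw [Over.comp_left, specTensor_left]
  exact (Iso.inv_comp_eq _).2 rfl

lemma toUnit_chartPoint (σ : PointedCone ℝ (RealSpace N)) :
    toUnit (specOver C) ≫ chartPoint σ =
      specOverMap ((Algebra.ofId ℂ C).comp (Bialgebra.counitAlgHom ℂ (ChartRing σ))) := by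
  ext1
  rw [Over.comp_left, Over.toUnit_left]
  refine Eq.trans (b := Spec.map (CommRingCat.ofHom (algebraMap ℂ C)) ≫
    Spec.map (CommRingCat.ofHom (Bialgebra.counitAlgHom ℂ (ChartRing σ)).toRingHom)) rfl ?_
  simp only [specOverMap_left, ← Spec.map_comp, ← CommRingCat.ofHom_comp]
  rfl

lemma toUnit_one_torus :
    toUnit (specOver C) ≫ MonObj.one (X := torus N) =
      specOverMap ((Algebra.ofId ℂ C).comp (Bialgebra.counitAlgHom ℂ (TorusRing N))) := by
  ext1
  rw [Over.comp_left, Over.toUnit_left]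
  refine Eq.trans (b := Spec.map (CommRingCat.ofHom (algebraMap ℂ C)) ≫
    Spec.map (CommRingCat.ofHom (Bialgebra.counitAlgHom ℂ (TorusRing N)).toRingHom)) rfl ?_
  simp only [specOverMap_left, ← Spec.map_comp, ← CommRingCat.ofHom_comp]
  rfl

lemma chart_one_act (σ : PointedCone ℝ (RealSpace N)) :
    MonObj.one (X := torus N) ▷ affineChart σ ≫ chartAct σ = (λ_ (affineChart σ)).hom := by
  have h : (λ_ (affineChart σ)).inv ≫ MonObj.one (X := torus N) ▷ affineChart σ =
      CartesianMonoidalCategory.lift (toUnit _ ≫ MonObj.one (X := torus N))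
        (specOverMap (AlgHom.id ℂ _)) := by
    rw [specOverMap_id]
    apply CartesianMonoidalCategory.hom_ext <;> simp
  rw [← Iso.inv_comp_eq_id, ← Category.assoc, h, toUnit_one_torus, lift_chartAct, ← specOverMap_id]
  congr 1
  apply monoidAlgebra_algHom_ext
  intro m
  simp [chartCoaction_single]

lemma productMap_comul_coaction {σ : PointedCone ℝ (RealSpace N)} (a b : TorusRing N →ₐ[ℂ] C)
    (c : ChartRing σ →ₐ[ℂ] C) :
    (Algebra.TensorProduct.productMap ((Algebra.TensorProduct.productMap a b).comp
        (Bialgebra.comulAlgHom ℂ (TorusRing N))) c).comp (chartCoaction σ) =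
      (Algebra.TensorProduct.productMap a ((Algebra.TensorProduct.productMap b c).comp
        (chartCoaction σ))).comp (chartCoaction σ) := by
  apply monoidAlgebra_algHom_ext
  intro m
  simp [chartCoaction_single, mul_assoc]

/-- The action on `X_σ` is associative. It suffices to test this on the universal point of
`T × T × X_σ` with values in the algebra `C`, an incarnation of `ℂ[M] ⊗ ℂ[M] ⊗ ℂ[σ^∨ ∩ M]`. -/
lemma chart_mul_act_of_isIso {σ : PointedCone ℝ (RealSpace N)}
    (j : TorusRing N ⊗[ℂ] TorusRing N →ₐ[ℂ] C) (i₃ : ChartRing σ →ₐ[ℂ] C)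
    [IsIso (CartesianMonoidalCategory.lift (specOverMap j) (specOverMap i₃))] :
    MonObj.mul (X := torus N) ▷ affineChart σ ≫ chartAct σ =
      (α_ (torus N) (torus N) (affineChart σ)).hom ≫ torus N ◁ chartAct σ ≫ chartAct σ := by
  let i₁ := j.comp Algebra.TensorProduct.includeLeft
  let i₂ := j.comp Algebra.TensorProduct.includeRight
  let e : specOver C ⟶ (torus N ⊗ torus N) ⊗ affineChart σ :=
    CartesianMonoidalCategory.lift (specOverMap j) (specOverMap i₃) ≫ specTensor _ _ ▷ _
  have he : e = CartesianMonoidalCategory.lift (CartesianMonoidalCategory.lift (specOverMap i₁)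
      (specOverMap i₂)) (specOverMap i₃) := by
    apply CartesianMonoidalCategory.hom_ext
    · apply CartesianMonoidalCategory.hom_ext
      · simp [e, specTensor, specOverMap_comp, i₁]
      · simp [e, specTensor, specOverMap_comp, i₂]
    · simp [e]
  rw [← cancel_epi e]
  have h1 : e ≫ MonObj.mul (X := torus N) ▷ affineChart σ =
      CartesianMonoidalCategory.lift (CartesianMonoidalCategory.lift (specOverMap i₁)
        (specOverMap i₂) ≫ MonObj.mul (X := torus N)) (specOverMap i₃) := by
    rw [he]
    apply CartesianMonoidalCategory.hom_ext <;> simp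
  have h2 : e ≫ (α_ (torus N) (torus N) (affineChart σ)).hom ≫ torus N ◁ chartAct σ =
      CartesianMonoidalCategory.lift (specOverMap i₁)
        (CartesianMonoidalCategory.lift (specOverMap i₂) (specOverMap i₃) ≫ chartAct σ) := by
    rw [he]
    apply CartesianMonoidalCategory.hom_ext
    · simp
    · simp only [Category.assoc, whiskerLeft_snd, lift_snd]
      rw [← Category.assoc, ← Category.assoc]
      congr 1
      apply CartesianMonoidalCategory.hom_ext <;> simp
  rw [← Category.assoc, h1, ← Category.assoc (α_ _ _ _).hom, ← Category.assoc, h2, lift_mul_torus,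
    lift_chartAct, lift_chartAct, lift_chartAct, productMap_comul_coaction]

lemma exists_algHom_isIso_lift (A B : Type) [CommRing A] [Algebra ℂ A] [CommRing B] [Algebra ℂ B] :
    ∃ (C : Type) (_ : CommRing C) (_ : Algebra ℂ C) (i : A →ₐ[ℂ] C) (j : B →ₐ[ℂ] C),
      IsIso (CartesianMonoidalCategory.lift (specOverMap i) (specOverMap j)) :=
  ⟨A ⊗[ℂ] B, inferInstance, inferInstance, Algebra.TensorProduct.includeLeft,
    Algebra.TensorProduct.includeRight, inferInstanceAs (IsIso (specTensor A B))⟩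

lemma chart_mul_act (σ : PointedCone ℝ (RealSpace N)) :
    MonObj.mul (X := torus N) ▷ affineChart σ ≫ chartAct σ =
      (α_ (torus N) (torus N) (affineChart σ)).hom ≫ torus N ◁ chartAct σ ≫ chartAct σ := by
  obtain ⟨C, _, _, i, j, _⟩ :=
    exists_algHom_isIso_lift (TorusRing N ⊗[ℂ] TorusRing N) (ChartRing σ)
  exact chart_mul_act_of_isIso i j

/-- The inclusion `ℂ[σ^∨ ∩ M] → ℂ[M]`. -/
noncomputable def chartToTorus (σ : PointedCone ℝ (RealSpace N)) : ChartRing σ →ₐ[ℂ] TorusRing N :=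
  AddMonoidAlgebra.mapDomainAlgHom ℂ ℂ (dualMonoid σ).subtype

/-- The orbit map of the base point of `X_σ`. -/
lemma chart_orbitMap (σ : PointedCone ℝ (RealSpace N)) :
    lift (𝟙 (torus N)) (toUnit (torus N) ≫ chartPoint σ) ≫ chartAct σ =
      specOverMap (chartToTorus σ) := by
  rw [← specOverMap_id, toUnit_chartPoint, lift_chartAct]
  congr 1
  apply monoidAlgebra_algHom_ext
  intro m
  simp [chartCoaction_single, chartToTorus]

instance : IsIso (specOverMap (chartToTorus (⊥ : PointedCone ℝ (RealSpace N)))) := by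
  have hb : Function.Bijective (dualMonoid (⊥ : PointedCone ℝ (RealSpace N))).subtype :=
    ⟨Subtype.val_injective, fun m => ⟨⟨m, fun x hx => by
      rw [Submodule.mem_bot] at hx; simp [hx]⟩, rfl⟩⟩
  let e := AddMonoidAlgebra.domCongr ℂ ℂ (AddEquiv.ofBijective _ hb)
  have he : chartToTorus (⊥ : PointedCone ℝ (RealSpace N)) = e.toAlgHom :=
    monoidAlgebra_algHom_ext fun m => by simp [e, chartToTorus]
  refine ⟨specOverMap e.symm.toAlgHom, ?_, ?_⟩
  · rw [specOverMap_comp, ← specOverMap_id, he]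
    congr 1
    apply AlgHom.ext; simp
  · rw [specOverMap_comp, ← specOverMap_id, he]
    congr 1
    apply AlgHom.ext; simp

end Points

namespace SimplicialAffineSystem

variable {N : Type} [AddCommGroup N] {I : Type} (S : SimplicialAffineSystem N I)
  [Module.Free ℤ N] [Module.Finite ℤ N]

lemma isPullback_whiskerLeft {Z A X : Over SpecC} (f : A ⟶ X) :
    IsPullback (Z ◁ f).left (snd Z A).left (snd Z X).left f.left := by
  have h : IsPullback (Z ◁ f) (snd Z A) (snd Z X) f := by
    refine ⟨⟨by simp⟩,
      ⟨PullbackCone.IsLimit.mk _ (fun s => lift (s.fst ≫ fst _ _) s.snd) ?_ ?_ ?_⟩⟩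
    · intro s
      apply CartesianMonoidalCategory.hom_ext
      · simp
      · simpa using s.condition.symm
    · intro s; simp
    · intro s m h1 h2
      apply CartesianMonoidalCategory.hom_ext
      · simp [← h1]
      · simpa using h2
  exact h.map (Over.forget SpecC)

instance {Z A X : Over SpecC} (f : A ⟶ X) [IsOpenImmersion f.left] :
    IsOpenImmersion (Z ◁ f).left :=
  MorphismProperty.of_isPullback (isPullback_whiskerLeft f).flip inferInstance

/-- Morphisms on `Z × X_S` can be compared on the charts. -/
lemma tensor_hom_ext {Z W : Over SpecC} {f g : Z ⊗ S.scheme ⟶ W}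
    (h : ∀ p, Z ◁ S.chartι p ≫ f = Z ◁ S.chartι p ≫ g) : f = g := by
  ext1
  refine Scheme.Cover.hom_ext (S.cover.pullback₁ (snd Z S.scheme).left) _ _ fun p => ?_
  change pullback.fst (snd Z S.scheme).left (S.chartι p).left ≫ f.left =
    pullback.fst (snd Z S.scheme).left (S.chartι p).left ≫ g.left
  rw [← (isPullback_whiskerLeft (Z := Z) (S.chartι p)).isoPullback_inv_fst, Category.assoc,
    Category.assoc, ← Over.comp_left, ← Over.comp_left, h p]

lemma hom_ext {W : Over SpecC} {f g : S.scheme ⟶ W}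
    (h : ∀ p, S.chartι p ≫ f = S.chartι p ≫ g) : f = g := by
  ext1
  refine colimit.hom_ext fun p => ?_
  exact congrArg CommaMorphism.left (h p)

lemma one_act : MonObj.one (X := torus N) ▷ S.scheme ≫ S.act = (λ_ S.scheme).hom := by
  refine S.tensor_hom_ext fun p => ?_
  rw [← Category.assoc, whisker_exchange, Category.assoc, whiskerLeft_chartι_act,
    ← Category.assoc, chart_one_act, leftUnitor_naturality]

lemma mul_act : MonObj.mul (X := torus N) ▷ S.scheme ≫ S.act =
    (α_ (torus N) (torus N) S.scheme).hom ≫ torus N ◁ S.act ≫ S.act := by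
  refine S.tensor_hom_ext fun p => ?_
  rw [← Category.assoc, whisker_exchange, Category.assoc, whiskerLeft_chartι_act,
    ← Category.assoc, chart_mul_act]
  simp only [Category.assoc]
  rw [← whiskerLeft_chartι_act, ← MonoidalCategory.whiskerLeft_comp_assoc, ← whiskerLeft_chartι_act]
  simp

end SimplicialAffineSystem

/-! ### `X_S` is a toric prevariety -/

lemma exists_whiskerLeft_eq {Z A X : Over SpecC} (f : A ⟶ X) [IsOpenImmersion f.left]
    {x : (Z ⊗ X).left} (hx : (snd Z X).left x ∈ f.left.opensRange) :
    ∃ w, (Z ◁ f).left w = x := by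
  have h := SimplicialAffineSystem.isPullback_whiskerLeft (Z := Z) f
  have hx' : x ∈ (pullback.fst (snd Z X).left f.left).opensRange := by
    rw [Scheme.Hom.opensRange_pullbackFst]; exact hx
  obtain ⟨w, hw⟩ := hx'
  refine ⟨h.isoPullback.inv w, ?_⟩
  rw [← Scheme.Hom.comp_apply, h.isoPullback_inv_fst, hw]

instance {N : Type} [AddCommGroup N] (σ : PointedCone ℝ (RealSpace N)) :
    IsAffine (affineChart σ).left :=
  inferInstanceAs (IsAffine (Spec (.of (ChartRing σ))))

instance {N : Type} [AddCommGroup N] [Module.Free ℤ N] [Module.Finite ℤ N]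
    (σ : PointedCone ℝ (RealSpace N)) : IsIntegral (affineChart σ).left :=
  inferInstanceAs (IsIntegral (Spec (.of (ChartRing σ))))

namespace SimplicialAffineSystem

variable {N : Type} [AddCommGroup N] {I : Type} (S : SimplicialAffineSystem N I)

lemma isRational_cone (p : S.Index) : IsRationalCone p.cone := (S.fan _ _).isRational _ p.mem

lemma le_maxIndex (p : S.Index) : p ≤ S.maxIndex p.idx :=
  ⟨(S.mem_fan_self_iff.1 p.mem).le, p.mem⟩

/-- The label `[0, i]` of the torus in the chart `i`. -/
def botIndex (i : I) : S.Index := ⟨⊥, i, Fan.bot_mem _⟩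

lemma botIndex_le (i : I) (p : S.Index) : S.botIndex i ≤ p := ⟨bot_le, Fan.bot_mem _⟩

variable [Module.Free ℤ N] [Module.Finite ℤ N]

lemma exists_chartι_eq (x : S.scheme.left) : ∃ i y, (S.chartι (S.maxIndex i)).left y = x := by
  obtain ⟨p, y, rfl⟩ : ∃ (p : S.Index) (y : (affineChart p.cone).left), (S.chartι p).left y = x :=
    S.cover.exists_eq x
  refine ⟨p.idx, (chartMap (S.le_maxIndex p).1).left y, ?_⟩
  rw [← Scheme.Hom.comp_apply, ← Over.comp_left, S.chartMap_chartι (S.le_maxIndex p)]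

lemma chart_mono {p q : S.Index} (h : p ≤ q) : S.chart p ≤ S.chart q := by
  rintro _ ⟨x, rfl⟩
  refine ⟨(chartMap h.1).left x, ?_⟩
  rw [← Scheme.Hom.comp_apply, ← Over.comp_left, S.chartMap_chartι h]

lemma iSup_chart_maxIndex : ⨆ i, S.chart (S.maxIndex i) = ⊤ := by
  refine top_le_iff.1 fun x _ => ?_
  obtain ⟨i, y, rfl⟩ := S.exists_chartι_eq x
  exact TopologicalSpace.Opens.mem_iSup.2 ⟨i, y, rfl⟩

lemma isAffineOpen_chart (p : S.Index) : IsAffineOpen (S.chart p) :=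
  isAffineOpen_opensRange _

lemma isIntegral_scheme [Nonempty I] : IsIntegral S.scheme.left := by
  have : ∀ p, AlgebraicGeometry.IsReduced (S.cover.X p) := fun p => by
    change AlgebraicGeometry.IsReduced (Spec (.of (ChartRing p.cone)))
    infer_instance
  have h1 : AlgebraicGeometry.IsReduced S.scheme.left := .of_openCover _ S.cover
  let o := S.botIndex (Classical.arbitrary I)
  -- every nonempty open set meets the torus
  have key : ∀ U : Set S.scheme.left, IsOpen U → U.Nonempty →
      ((S.chartι o).left ⁻¹' U).Nonempty := by
    rintro U hU ⟨x, hx⟩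
    obtain ⟨i, y, rfl⟩ := S.exists_chartι_eq x
    have ho := S.botIndex_le (Classical.arbitrary I) (S.maxIndex i)
    have : IsOpenImmersion (chartMap ho.1).left :=
      instIsOpenImmersionMapDiagram S (homOfLE ho)
    have h2 : (Set.range (chartMap ho.1).left).Nonempty := Set.range_nonempty _
    obtain ⟨_, h3, ⟨z, rfl⟩⟩ := nonempty_preirreducible_inter
      (hU.preimage (S.chartι (S.maxIndex i)).left.continuous)
      (chartMap ho.1).left.isOpenEmbedding.isOpen_range ⟨y, hx⟩ h2
    refine ⟨z, ?_⟩
    rw [Set.mem_preimage, ← S.chartMap_chartι ho]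
    exact h3
  have h2 : PreirreducibleSpace S.scheme.left :=
    .of_forall_nonempty_inter fun U V hU hV hU' hV' => by
    obtain ⟨z, hz⟩ := nonempty_preirreducible_inter
      (hU.preimage (S.chartι o).left.continuous) (hV.preimage (S.chartι o).left.continuous)
      (key U hU hU') (key V hV hV')
    exact ⟨_, hz⟩
  have h3 : IrreducibleSpace S.scheme.left :=
    { toNonempty := ⟨(S.chartι o).left (Classical.arbitrary _)⟩ }
  exact isIntegral_of_irreducibleSpace_of_isReduced _

lemma locallyOfFiniteType_scheme : LocallyOfFiniteType S.scheme.hom := by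
  have : IsZariskiLocalAtSource @LocallyOfFiniteType :=
    HasRingHomProperty.instIsZariskiLocalAtSource (Q := RingHom.FiniteType)
  refine (IsZariskiLocalAtSource.iff_of_openCover S.cover).2 fun p => ?_
  change LocallyOfFiniteType ((S.chartι p).left ≫ S.scheme.hom)
  rw [Over.w]
  change LocallyOfFiniteType (Spec.map _)
  rw [HasRingHomProperty.Spec_iff (P := @LocallyOfFiniteType)]
  simpa [RingHom.finiteType_algebraMap] using finiteType_chartRing (S.isRational_cone p)

lemma quasiCompact_scheme [Finite I] : QuasiCompact S.scheme.hom := by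
  rw [quasiCompact_iff_compactSpace]
  refine ⟨?_⟩
  have h := congrArg (fun U : S.scheme.left.Opens => (U : Set S.scheme.left)) S.iSup_chart_maxIndex
  simp only [TopologicalSpace.Opens.coe_iSup, TopologicalSpace.Opens.coe_top] at h
  rw [← h]
  exact isCompact_iUnion fun i => (S.isAffineOpen_chart _).isCompact

lemma isIntegrallyClosed_stalk (x : S.scheme.left) :
    IsIntegrallyClosed (S.scheme.left.presheaf.stalk x) := by
  obtain ⟨i, y, rfl⟩ := S.exists_chartι_eq x
  let σ := (S.maxIndex i).cone
  have := isIntegrallyClosed_chartRing (S.isRational_cone (S.maxIndex i))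
  let y' : PrimeSpectrum (ChartRing σ) := y
  let k : Algebra (ChartRing σ) ((Spec (.of (ChartRing σ))).presheaf.stalk y) :=
    StructureSheaf.stalkAlgebra (ChartRing σ) y
  have hloc : IsLocalization.AtPrime ((Spec (.of (ChartRing σ))).presheaf.stalk y)
    y'.asIdeal := StructureSheaf.IsLocalization.to_stalk (ChartRing σ) y
  have h := isIntegrallyClosed_of_isLocalization
    ((Spec (.of (ChartRing σ))).presheaf.stalk y) y'.asIdeal.primeCompl
    y'.asIdeal.primeCompl_le_nonZeroDivisors
  exact h.of_equiv
    (asIso ((S.chartι (S.maxIndex i)).left.stalkMap y)).symm.commRingCatIsoToRingEquiv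

lemma isStable_chart [Nonempty I] (p : S.Index) : S.toricPrevariety.IsStable (S.chart p) := by
  intro x hx
  obtain ⟨w, rfl⟩ := exists_whiskerLeft_eq (Z := torus N) (S.chartι p) hx
  change S.act.left _ ∈ S.chart p
  rw [← Scheme.Hom.comp_apply, ← Over.comp_left, whiskerLeft_chartι_act, Over.comp_left,
    Scheme.Hom.comp_apply]
  exact ⟨_, rfl⟩

lemma isChart_chart [Nonempty I] (p : S.Index) : S.toricPrevariety.IsChart (S.chart p) :=
  ⟨S.isAffineOpen_chart p, S.isStable_chart p⟩

lemma orbitMap_eq [Nonempty I] (p : S.Index) :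
    S.toricPrevariety.orbitMap = specOverMap (chartToTorus p.cone) ≫ S.chartι p := by
  rw [TorusScheme.orbitMap, S.base_eq p]
  change (ρ_ (torus N)).inv ≫ torus N ◁ (chartPoint p.cone ≫ S.chartι p) ≫ S.act = _
  rw [← chart_orbitMap, Category.assoc, ← S.whiskerLeft_chartι_act, ← Category.assoc,
    ← Category.assoc]
  congr 1
  apply CartesianMonoidalCategory.hom_ext <;> simp

/-- `X_S` is a toric prevariety. -/
theorem isToricPrevariety [Finite I] [Nonempty I] : S.toricPrevariety.IsToricPrevariety where
  isIntegral := S.isIntegral_scheme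
  locallyOfFiniteType := S.locallyOfFiniteType_scheme
  quasiCompact := S.quasiCompact_scheme
  isNormal := S.isIntegrallyClosed_stalk
  one_act := S.one_act
  mul_act := S.mul_act
  isOpenImmersion_orbitMap := by
    rw [S.orbitMap_eq (S.botIndex (Classical.arbitrary I))]
    have : IsIso (specOverMap (chartToTorus (S.botIndex (Classical.arbitrary I)).cone)).left :=
      inferInstanceAs (IsIso ((Over.forget SpecC).map
        (specOverMap (chartToTorus (⊥ : PointedCone ℝ (RealSpace N))))))
    have : IsOpenImmersion
        (specOverMap (chartToTorus (S.botIndex (Classical.arbitrary I)).cone)).left := inferInstance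
    exact IsOpenImmersion.comp
      (specOverMap (chartToTorus (S.botIndex (Classical.arbitrary I)).cone)).left
      (S.chartι (S.botIndex (Classical.arbitrary I))).left
  exists_chart x := by
    obtain ⟨i, y, rfl⟩ := S.exists_chartι_eq x
    exact ⟨S.chart (S.maxIndex i), ⟨y, rfl⟩, S.isChart_chart _⟩

end SimplicialAffineSystem

/-! ### Affine schemes over `ℂ` -/

section SpecOver

variable {A B C : Type} [CommRing A] [Algebra ℂ A] [CommRing B] [Algebra ℂ B]
  [CommRing C] [Algebra ℂ C]

lemma exists_specOverMap_eq (g : specOver B ⟶ specOver A) : ∃ a : A →ₐ[ℂ] B, specOverMap a = g := by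
  have h : CommRingCat.ofHom (algebraMap ℂ A) ≫ Spec.preimage g.left =
      CommRingCat.ofHom (algebraMap ℂ B) := by
    apply Spec.map_injective
    rw [Spec.map_comp, Spec.map_preimage]
    exact Over.w g
  refine ⟨{ (Spec.preimage g.left).hom with commutes' := fun r => congr($h r) }, ?_⟩
  ext1
  exact Spec.map_preimage g.left

lemma specOverMap_injective {a b : A →ₐ[ℂ] B} (h : specOverMap a = specOverMap b) : a = b := by
  have h1 := Spec.map_injective (congrArg CommaMorphism.left h)
  ext x
  exact congr($h1 x)

lemma specTensor_whiskerLeft (a : A →ₐ[ℂ] B) :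
    specTensor C B ≫ specOver C ◁ specOverMap a =
      specOverMap (Algebra.TensorProduct.map (AlgHom.id ℂ C) a) ≫ specTensor C A := by
  apply CartesianMonoidalCategory.hom_ext
  · simp only [specTensor, Category.assoc, whiskerLeft_fst, lift_fst, specOverMap_comp]
    congr 1
    ext
    simp
  · simp only [specTensor, Category.assoc, whiskerLeft_snd, lift_snd, lift_snd_assoc,
      specOverMap_comp]
    congr 1

/-- An affine open subscheme of a scheme over `ℂ` as the spectrum of a `ℂ`-algebra. -/
lemma exists_specOver_of_isAffineOpen {X : Over SpecC} {U : X.left.Opens} (hU : IsAffineOpen U) :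
    ∃ (B : Type) (_ : CommRing B) (_ : Algebra ℂ B) (j : specOver B ⟶ X)
      (_ : IsOpenImmersion j.left), j.left.opensRange = U := by
  let a := Spec.preimage (hU.fromSpec ≫ X.hom)
  let _ : Algebra ℂ Γ(X.left, U) := a.hom.toAlgebra
  have h : Spec.map (CommRingCat.ofHom (algebraMap ℂ Γ(X.left, U))) = hU.fromSpec ≫ X.hom :=
    Spec.map_preimage _
  exact ⟨Γ(X.left, U), inferInstance, inferInstance, Over.homMk hU.fromSpec h.symm,
    inferInstanceAs (IsOpenImmersion hU.fromSpec), hU.opensRange_fromSpec⟩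

/-- A morphism into the image of an open immersion over `ℂ` factors through it. -/
lemma exists_lift_of_isOpenImmersion {X Z W : Over SpecC} (j : W ⟶ X) [IsOpenImmersion j.left]
    (f : Z ⟶ X) (h : ∀ z, f.left z ∈ j.left.opensRange) : ∃ l : Z ⟶ W, l ≫ j = f := by
  have h' : Set.range f.left ⊆ Set.range j.left := by
    rintro _ ⟨z, rfl⟩; exact h z
  refine ⟨Over.homMk (IsOpenImmersion.lift j.left f.left h') ?_, ?_⟩
  · rw [← Over.w j, IsOpenImmersion.lift_fac_assoc, Over.w f]
  · ext1
    exact IsOpenImmersion.lift_fac _ _ _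

lemma mono_of_isOpenImmersion {W X : Over SpecC} (j : W ⟶ X) [IsOpenImmersion j.left] : Mono j :=
  (Over.forget SpecC).mono_of_mono_map (inferInstanceAs (Mono j.left))

end SpecOver

/-! ### Orbits and stable open subsets -/

lemma TorusScheme.orbitMap_eq_lift {N : Type} [AddCommGroup N] (Y : TorusScheme N) : Y.orbitMap =
    CartesianMonoidalCategory.lift (𝟙 (torus N)) (toUnit _ ≫ Y.base) ≫ Y.act := by
  rw [TorusScheme.orbitMap, ← Category.assoc]
  congr 1
  apply CartesianMonoidalCategory.hom_ext <;> simp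

namespace TorusScheme.IsToricPrevariety

variable {N : Type} [AddCommGroup N] {Y : TorusScheme N} (hY : Y.IsToricPrevariety)

include hY

/-- In terms of points, `t⁻¹ • (t • x) = x`. -/
lemma lift_inv_act :
    CartesianMonoidalCategory.lift (fst (torus N) Y.X ≫ GrpObj.inv) Y.act ≫ Y.act =
      snd (torus N) Y.X := by
  have h1 : CartesianMonoidalCategory.lift (fst (torus N) Y.X ≫ GrpObj.inv) Y.act =
      CartesianMonoidalCategory.lift (CartesianMonoidalCategory.lift
        (fst (torus N) Y.X ≫ GrpObj.inv) (fst (torus N) Y.X)) (snd (torus N) Y.X) ≫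
        (α_ (torus N) (torus N) Y.X).hom ≫ torus N ◁ Y.act := by
    apply CartesianMonoidalCategory.hom_ext
    · simp
    · simp only [lift_snd, Category.assoc, whiskerLeft_snd]
      rw [← Category.assoc, ← Category.assoc]
      conv_lhs => rw [← Category.id_comp Y.act]
      congr 1
      apply CartesianMonoidalCategory.hom_ext <;> simp
  have h2 : CartesianMonoidalCategory.lift (CartesianMonoidalCategory.lift
      (fst (torus N) Y.X ≫ GrpObj.inv) (fst (torus N) Y.X)) (snd (torus N) Y.X) ≫
        MonObj.mul (X := torus N) ▷ Y.X =
      CartesianMonoidalCategory.lift (toUnit _) (snd (torus N) Y.X) ≫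
        MonObj.one (X := torus N) ▷ Y.X := by
    apply CartesianMonoidalCategory.hom_ext
    · simp
    · simp
  rw [h1, Category.assoc, Category.assoc, ← hY.mul_act, ← Category.assoc, h2, Category.assoc,
    hY.one_act]
  simp

/-- In terms of points, `t • x ∈ V` if and only if `x ∈ V`. -/
lemma act_mem_iff {V : Y.X.left.Opens} (hV : Y.IsStable V) (x : (torus N ⊗ Y.X).left) :
    Y.act.left x ∈ V ↔ (snd (torus N) Y.X).left x ∈ V := by
  refine ⟨fun h => ?_, fun h => hV h⟩
  let s := CartesianMonoidalCategory.lift (fst (torus N) Y.X ≫ GrpObj.inv) Y.act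
  have h1 : (snd (torus N) Y.X).left (s.left x) = Y.act.left x := by
    rw [← Scheme.Hom.comp_apply, ← Over.comp_left, lift_snd]
  have h2 : Y.act.left (s.left x) = (snd (torus N) Y.X).left x := by
    rw [← Scheme.Hom.comp_apply, ← Over.comp_left, hY.lift_inv_act]
  rw [← h2]
  apply hV
  change (snd (torus N) Y.X).left (s.left x) ∈ V
  rwa [h1]

/-- The orbit map is equivariant. -/
lemma mul_orbitMap :
    MonObj.mul (X := torus N) ≫ Y.orbitMap = torus N ◁ Y.orbitMap ≫ Y.act := by
  rw [Y.orbitMap_eq_lift, MonoidalCategory.whiskerLeft_comp, Category.assoc]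
  have h1 : torus N ◁ CartesianMonoidalCategory.lift (𝟙 (torus N)) (toUnit _ ≫ Y.base) =
      CartesianMonoidalCategory.lift (𝟙 (torus N ⊗ torus N)) (toUnit _ ≫ Y.base) ≫
        (α_ (torus N) (torus N) Y.X).hom := by
    apply CartesianMonoidalCategory.hom_ext
    · simp
    · apply CartesianMonoidalCategory.hom_ext
      · simp
      · simp
  rw [h1, Category.assoc, ← hY.mul_act, ← Category.assoc, ← Category.assoc]
  congr 1
  apply CartesianMonoidalCategory.hom_ext
  · simp
  · simp

/-- A stable open subset that contains one point of the open orbit contains all of them: both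
amount to containing the base point. -/
lemma orbitMap_mem_iff {V : Y.X.left.Opens} (hV : Y.IsStable V) (t t' : (torus N).left) :
    Y.orbitMap.left t ∈ V ↔ Y.orbitMap.left t' ∈ V := by
  have h : ∀ t, Y.orbitMap.left t ∈ V ↔ Y.base.left ((toUnit (torus N)).left t) ∈ V := by
    intro t
    rw [Y.orbitMap_eq_lift, Over.comp_left, Scheme.Hom.comp_apply, hY.act_mem_iff hV,
      ← Scheme.Hom.comp_apply, ← Over.comp_left, lift_snd, Over.comp_left, Scheme.Hom.comp_apply]
  have : Subsingleton (𝟙_ (Over SpecC)).left :=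
    inferInstanceAs (Subsingleton (PrimeSpectrum ℂ))
  rw [h, h, Subsingleton.elim ((toUnit (torus N)).left t) ((toUnit (torus N)).left t')]

/-- A nonempty stable open subset contains the open orbit, since the orbit is dense. -/
lemma orbitMap_mem [Module.Free ℤ N] [Module.Finite ℤ N] {V : Y.X.left.Opens} (hV : Y.IsStable V)
    (hne : (V : Set Y.X.left).Nonempty) (t : (torus N).left) : Y.orbitMap.left t ∈ V := by
  have := hY.isIntegral
  have := hY.isOpenImmersion_orbitMap
  obtain ⟨_, h1, ⟨t', rfl⟩⟩ := nonempty_preirreducible_inter V.isOpen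
    Y.orbitMap.left.isOpenEmbedding.isOpen_range hne ⟨_, t, rfl⟩
  exact (hY.orbitMap_mem_iff hV t' t).1 h1

end TorusScheme.IsToricPrevariety

/-! ### Stable coverings of stable affine charts -/

section Coefficient

variable {N : Type} [AddCommGroup N] {B : Type} [CommRing B] [Algebra ℂ B]

variable (N) in
/-- The coefficient of `χ^0`, as a linear form on `ℂ[M]`. -/
noncomputable def constCoeff : TorusRing N →ₗ[ℂ] ℂ where
  toFun x := x.coeff 0
  map_add' := by simp
  map_smul' := by simp

lemma constCoeff_apply (x : TorusRing N) : constCoeff N x = x.coeff 0 := rfl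

lemma constCoeff_one : constCoeff N 1 = 1 := by
  simp [constCoeff_apply, AddMonoidAlgebra.one_def]

variable (N B) in
/-- The coefficient of `χ^0`, as a map `ℂ[M] ⊗ B → B`. -/
noncomputable def tensorConstCoeff : TorusRing N ⊗[ℂ] B →ₗ[ℂ] B :=
  (TensorProduct.lid ℂ B).toLinearMap ∘ₗ LinearMap.rTensor B (constCoeff N)

@[simp]
lemma tensorConstCoeff_tmul (x : TorusRing N) (b : B) :
    tensorConstCoeff N B (x ⊗ₜ b) = constCoeff N x • b := by
  simp [tensorConstCoeff]

lemma tensorConstCoeff_map {C : Type} [CommRing C] [Algebra ℂ C] (f : B →ₐ[ℂ] C)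
    (z : TorusRing N ⊗[ℂ] B) :
    tensorConstCoeff N C (Algebra.TensorProduct.map (AlgHom.id ℂ _) f z) =
      f (tensorConstCoeff N B z) := by
  induction z using TensorProduct.induction_on with
  | zero => simp
  | tmul x b => simp
  | add x y hx hy => simp only [map_add, hx, hy]

lemma tensorConstCoeff_comul (x : TorusRing N) :
    tensorConstCoeff N (TorusRing N) (Bialgebra.comulAlgHom ℂ (TorusRing N) x) =
      algebraMap ℂ _ (constCoeff N x) := by
  classical
  induction x using AddMonoidAlgebra.induction_linear with
  | zero => simp
  | add x y hx hy => simp only [map_add, hx, hy]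
  | single m a =>
    by_cases h : m = 0
    · subst h
      simp [constCoeff_apply, Algebra.algebraMap_eq_smul_one, AddMonoidAlgebra.one_def]
    · simp [constCoeff_apply, h]

end Coefficient

namespace TorusScheme.IsToricPrevariety

variable {N : Type} [AddCommGroup N] [Module.Free ℤ N] [Module.Finite ℤ N] {Y : TorusScheme N}
  (hY : Y.IsToricPrevariety)

include hY

/-- On a stable affine chart `Spec B` there is a linear form on `B`, the coefficient of `χ^0` with
respect to `B ⊆ ℂ[M]`, that vanishes on the vanishing ideal of every nonempty stable closed subset.
If `P` is a point of such a subset and `P'` consists of the functions all whose homogeneous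
components lie in `P`, then `P'` belongs to that subset, too, and contains no function with a
nonzero constant coefficient. -/
lemma exists_constCoeff {B : Type} [CommRing B] [Algebra ℂ B] (j : specOver B ⟶ Y.X)
    [IsOpenImmersion j.left] (hj : Y.IsStable j.left.opensRange) [Nonempty (PrimeSpectrum B)] :
    ∃ ℓ : B →ₗ[ℂ] ℂ, ℓ 1 = 1 ∧ ∀ P : PrimeSpectrum B, ∃ P' : PrimeSpectrum B,
      (∀ V, Y.IsStable V → (j.left P ∈ V ↔ j.left P' ∈ V)) ∧ ∀ a ∈ P'.asIdeal, ℓ a = 0 := by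
  have := mono_of_isOpenImmersion j
  have := hY.isIntegral
  have := hY.isOpenImmersion_orbitMap
  -- the action and the orbit map of the chart
  obtain ⟨c', hc'⟩ := exists_lift_of_isOpenImmersion j (torus N ◁ j ≫ Y.act) fun z => by
    apply hj
    change (snd (torus N) Y.X).left ((torus N ◁ j).left z) ∈ j.left.opensRange
    rw [← Scheme.Hom.comp_apply, ← Over.comp_left, whiskerLeft_snd]
    exact ⟨_, rfl⟩
  obtain ⟨c, hc⟩ := exists_specOverMap_eq (specTensor _ _ ≫ c')
  obtain ⟨ψ', hψ'⟩ := exists_lift_of_isOpenImmersion j Y.orbitMap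
    (hY.orbitMap_mem hj ⟨_, Classical.arbitrary (PrimeSpectrum B), rfl⟩)
  obtain ⟨ψ, rfl⟩ := exists_specOverMap_eq ψ'
  -- the orbit is dense in the chart
  have hψinj : Function.Injective ψ := by
    have h1 : IsOpenImmersion (specOverMap ψ).left := by
      have : IsOpenImmersion ((specOverMap ψ).left ≫ j.left) := by
        rw [← Over.comp_left, hψ']; infer_instance
      exact IsOpenImmersion.of_comp _ j.left
    have : Nonempty (specOver B).left := inferInstanceAs (Nonempty (PrimeSpectrum B))
    have : IsIntegral (specOver B).left := isIntegral_of_isOpenImmersion j.left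
    have : IsDomain B := (affine_isIntegral_iff (.of B)).1 this
    have h2 : DenseRange (PrimeSpectrum.comap ψ.toRingHom) :=
      IsOpen.dense (X := PrimeSpectrum B) (specOverMap ψ).left.isOpenEmbedding.isOpen_range
        (Set.range_nonempty (ι := PrimeSpectrum (TorusRing N)) _)
    rw [PrimeSpectrum.denseRange_comap_iff_ker_le_nilRadical, nilradical_eq_zero] at h2
    exact (RingHom.injective_iff_ker_eq_bot ψ.toRingHom).2 (le_bot_iff.1 h2)
  -- the orbit map is equivariant
  have hequiv : (Algebra.TensorProduct.map (AlgHom.id ℂ _) ψ).comp c =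
      (Bialgebra.comulAlgHom ℂ (TorusRing N)).comp ψ := by
    have h1 : torus N ◁ specOverMap ψ ≫ c' = MonObj.mul (X := torus N) ≫ specOverMap ψ := by
      rw [← cancel_mono j, Category.assoc, Category.assoc, hc', hψ', hY.mul_orbitMap, ← hψ',
        MonoidalCategory.whiskerLeft_comp, Category.assoc]
    have h2 : specTensor (TorusRing N) (TorusRing N) ≫ MonObj.mul (X := torus N) =
        specOverMap (Bialgebra.comulAlgHom ℂ (TorusRing N)) := by
      rw [specTensor, lift_mul_torus, Algebra.TensorProduct.productMap_eq_comp_map]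
      congr 1
      ext
      simp
    apply specOverMap_injective
    rw [← specOverMap_comp, ← specOverMap_comp, hc, ← Category.assoc, ← specTensor_whiskerLeft,
      Category.assoc, h1, ← Category.assoc, h2]
  -- the homogeneous component of degree `0` of a function is constant
  have hconst : ∀ b, tensorConstCoeff N B (c b) = algebraMap ℂ B (constCoeff N (ψ b)) := by
    intro b
    apply hψinj
    rw [← tensorConstCoeff_map, ψ.commutes, ← tensorConstCoeff_comul]
    exact congrArg _ (DFunLike.congr_fun hequiv b)
  refine ⟨constCoeff N ∘ₗ ψ.toLinearMap, by simp [constCoeff_one], fun P => ?_⟩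
  -- `w` is the generic point of `T × {P}`, and `P'` is its image under the action
  let π := Ideal.Quotient.mkₐ ℂ P.asIdeal
  let q := Algebra.TensorProduct.map (AlgHom.id ℂ (TorusRing N)) π
  let w : PrimeSpectrum (TorusRing N ⊗[ℂ] B) := ⟨RingHom.ker q, RingHom.ker_isPrime _⟩
  have hq : ∀ z ∈ w.asIdeal, tensorConstCoeff N B z ∈ P.asIdeal := by
    intro z hz
    have hz' : q z = 0 := hz
    have h := tensorConstCoeff_map π z
    rw [hz', map_zero] at h
    exact Ideal.Quotient.eq_zero_iff_mem.1 h.symm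
  have hsnd : (specOverMap (Algebra.TensorProduct.includeRight :
      B →ₐ[ℂ] TorusRing N ⊗[ℂ] B)).left w = P := by
    refine PrimeSpectrum.ext (Ideal.ext fun b => ?_)
    constructor
    · intro hb
      have := hq _ hb
      simpa [constCoeff_one] using this
    · intro hb
      change q (1 ⊗ₜ b) = 0
      have : π b = 0 := Ideal.Quotient.eq_zero_iff_mem.2 hb
      simp [q, this]
  refine ⟨PrimeSpectrum.comap c.toRingHom w, fun V hV => ?_, fun a ha => ?_⟩
  · let w' : (specOver (TorusRing N ⊗[ℂ] B)).left := w
    have h1 := hY.act_mem_iff hV ((torus N ◁ j).left ((specTensor _ _).left w'))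
    have e1 : Y.act.left ((torus N ◁ j).left ((specTensor _ _).left w')) =
        j.left ((specOverMap c).left w') := by
      have e : specTensor (TorusRing N) B ≫ torus N ◁ j ≫ Y.act = specOverMap c ≫ j := by
        rw [hc, Category.assoc, hc']
      exact congrArg (fun f => f.left w') e
    have e2 : (snd (torus N) Y.X).left ((torus N ◁ j).left ((specTensor _ _).left w')) =
        j.left P := by
      have e : specTensor (TorusRing N) B ≫ torus N ◁ j ≫ snd (torus N) Y.X =
          specOverMap Algebra.TensorProduct.includeRight ≫ j := by
        rw [whiskerLeft_snd, ← Category.assoc, specTensor, CartesianMonoidalCategory.lift_snd]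
      exact (congrArg (fun f => f.left w') e).trans (congrArg j.left hsnd)
    rw [e1, e2] at h1
    exact h1.symm
  · have h1 := hq _ ha
    rw [show tensorConstCoeff N B (c.toRingHom a) = _ from hconst a] at h1
    by_contra h2
    exact P.isPrime.ne_top (Ideal.eq_top_of_isUnit_mem _ h1 ((Ne.isUnit h2).map (algebraMap ℂ B)))

/-- If stable open subsets cover a stable affine chart, then one of them contains it: the vanishing
ideals of their complements would otherwise all lie in the kernel of a linear form that does not
vanish at `1`. (Equivalently, the chart has a smallest nonempty stable closed subset.) -/
theorem exists_le_of_le_iSup {U : Y.X.left.Opens} (hU : Y.IsChart U)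
    (hne : (U : Set Y.X.left).Nonempty) {ι : Type*} (V : ι → Y.X.left.Opens)
    (hV : ∀ i, Y.IsStable (V i)) (h : U ≤ ⨆ i, V i) : ∃ i, U ≤ V i := by
  obtain ⟨hU, hst⟩ := hU
  obtain ⟨B, _, _, j, _, rfl⟩ := exists_specOver_of_isAffineOpen hU
  obtain ⟨_, x, -⟩ := hne
  have : Nonempty (PrimeSpectrum B) := ⟨x⟩
  obtain ⟨ℓ, h1, hℓ⟩ := hY.exists_constCoeff j hst
  by_contra! hcon
  let Z : ι → Set (PrimeSpectrum B) := fun i => {P | j.left P ∉ V i}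
  have hZ : ∀ i, ∀ a ∈ PrimeSpectrum.vanishingIdeal (Z i), ℓ a = 0 := by
    intro i a ha
    obtain ⟨_, ⟨P, rfl⟩, hP⟩ := Set.not_subset.1 (hcon i)
    obtain ⟨P', h2, h3⟩ := hℓ P
    exact h3 a ((PrimeSpectrum.mem_vanishingIdeal _ _).1 ha P' fun h4 => hP ((h2 _ (hV i)).2 h4))
  have htop : ⨆ i, PrimeSpectrum.vanishingIdeal (Z i) = ⊤ := by
    rw [← PrimeSpectrum.zeroLocus_empty_iff_eq_top, PrimeSpectrum.zeroLocus_iSup]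
    refine Set.eq_empty_of_forall_notMem fun P hP => ?_
    obtain ⟨i, hi⟩ := TopologicalSpace.Opens.mem_iSup.1 (h ⟨P, rfl⟩)
    have h2 := Set.mem_iInter.1 hP i
    have hcl : IsClosed (Z i) := ((V i).isOpen.preimage j.left.continuous).isClosed_compl
    rw [PrimeSpectrum.zeroLocus_vanishingIdeal_eq_closure, hcl.closure_eq] at h2
    exact h2 hi
  have hmem : ∀ a ∈ ⨆ i, PrimeSpectrum.vanishingIdeal (Z i), ℓ a = 0 := fun a ha => by
    induction ha using Submodule.iSup_induction' with
    | mem i a ha => exact hZ i a ha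
    | zero => exact map_zero _
    | add a b _ _ ha hb => rw [map_add, ha, hb, add_zero]
  have h0 := hmem 1 (htop ▸ Submodule.mem_top)
  rw [h1] at h0
  exact one_ne_zero h0

end TorusScheme.IsToricPrevariety

/-! ### Maximal charts and toric morphisms -/

namespace TorusScheme

variable {N N' : Type} [AddCommGroup N] [AddCommGroup N'] {Y : TorusScheme N} {Y' : TorusScheme N'}

/-- Maximal stable affine charts exist because a scheme of finite type over `ℂ` is a Noetherian
space. -/
lemma IsToricPrevariety.exists_le_maximal (hY : Y.IsToricPrevariety) {U : Y.X.left.Opens}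
    (hU : Y.IsChart U) : ∃ V, U ≤ V ∧ Maximal Y.IsChart V := by
  have := hY.locallyOfFiniteType
  have := hY.quasiCompact
  have : IsLocallyNoetherian Y.X.left := LocallyOfFiniteType.isLocallyNoetherian Y.X.hom
  have : CompactSpace Y.X.left := QuasiCompact.compactSpace_of_compactSpace Y.X.hom
  have : IsNoetherian Y.X.left := {}
  have : WellFoundedGT Y.X.left.Opens :=
    inferInstanceAs (TopologicalSpace.NoetherianSpace Y.X.left)
  obtain ⟨V, ⟨hUV, hV⟩, hmax⟩ :=
    wellFounded_gt.has_min {V : Y.X.left.Opens | U ≤ V ∧ Y.IsChart V} ⟨U, le_rfl, hU⟩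
  refine ⟨V, hUV, hV, fun W hW hVW => ?_⟩
  by_contra h
  exact hmax W ⟨hUV.trans hVW, hW⟩ (lt_of_le_not_ge hVW h)

lemma IsToricMorphism.isStable_preimage {f : Y.X ⟶ Y'.X} (hf : IsToricMorphism Y Y' f)
    {V : Y'.X.left.Opens} (hV : Y'.IsStable V) : Y.IsStable (f.left ⁻¹ᵁ V) := by
  obtain ⟨-, φ, -, hact⟩ := hf
  intro x hx
  change f.left (Y.act.left x) ∈ V
  rw [← Scheme.Hom.comp_apply, ← Over.comp_left, hact, Over.comp_left, Scheme.Hom.comp_apply]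
  apply hV
  change (snd (torus N') Y'.X).left ((φ ⊗ₘ f).left x) ∈ V
  rw [← Scheme.Hom.comp_apply, ← Over.comp_left, tensorHom_snd, Over.comp_left,
    Scheme.Hom.comp_apply]
  exact hx

end TorusScheme

/-- An open subscheme on which `g` is an open immersion is isomorphic to its image. -/
lemma exists_iso_opensRange {X Z W : Scheme.{0}} (j : X ⟶ Z) (k : X ⟶ W) [IsOpenImmersion j]
    [IsOpenImmersion k] {g : Z ⟶ W} (h : j ≫ g = k) :
    ∃ e : j.opensRange.toScheme ≅ k.opensRange.toScheme,
      e.hom ≫ k.opensRange.ι = j.opensRange.ι ≫ g := by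
  refine ⟨j.isoOpensRange.symm ≪≫ k.isoOpensRange, ?_⟩
  simp only [Iso.trans_hom, Iso.symm_hom, Category.assoc, Scheme.Hom.isoOpensRange_hom_ι]
  rw [← h, ← Category.assoc, Scheme.Hom.isoOpensRange_inv_comp]

/-! ### Morphisms from affine toric varieties to affine schemes -/

section Torus

variable {N : Type} [AddCommGroup N]

lemma chartRestrict_injective {τ σ : PointedCone ℝ (RealSpace N)} (h : τ ≤ σ) :
    Function.Injective (chartRestrict h) :=
  AddMonoidAlgebra.mapDomain_injective (AddSubmonoid.inclusion_injective _)

/-- Within the functions on `X_τ`, those on `X_σ` are the linear combinations of the `χ^m` with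
`m ∈ σ^∨`. -/
lemma mem_range_chartRestrict_iff {τ σ : PointedCone ℝ (RealSpace N)} (h : τ ≤ σ)
    {x : ChartRing τ} : x ∈ (chartRestrict h).range ↔
      ∀ m ∈ x.coeff.support, (m : Module.Dual ℤ N) ∈ dualMonoid σ := by
  classical
  constructor
  · rintro ⟨y, rfl⟩ m hm
    obtain ⟨n, -, rfl⟩ := Finset.mem_image.1 (Finsupp.mapDomain_support hm)
    exact n.2
  · intro hx
    rw [← AddMonoidAlgebra.sum_coeff_single x]
    refine sum_mem fun m hm => ?_
    exact ⟨.single ⟨m, hx m hm⟩ (x.coeff m), chartRestrict_single _ _ _⟩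

/-- Two morphisms from `X_σ` to an affine scheme agree if they agree on the torus. -/
lemma affineChart_hom_ext {X : Over SpecC} {U : X.left.Opens} (hU : IsAffineOpen U)
    {σ : PointedCone ℝ (RealSpace N)} {f g : affineChart σ ⟶ X} (hf : ∀ x, f.left x ∈ U)
    (hg : ∀ x, g.left x ∈ U) (h : chartMap (bot_le : ⊥ ≤ σ) ≫ f = chartMap bot_le ≫ g) :
    f = g := by
  obtain ⟨B, _, _, j, _, rfl⟩ := exists_specOver_of_isAffineOpen hU
  have := mono_of_isOpenImmersion j
  obtain ⟨f', rfl⟩ := exists_lift_of_isOpenImmersion j f hf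
  obtain ⟨g', rfl⟩ := exists_lift_of_isOpenImmersion j g hg
  obtain ⟨a, rfl⟩ := exists_specOverMap_eq f'
  obtain ⟨b, rfl⟩ := exists_specOverMap_eq g'
  rw [← Category.assoc, ← Category.assoc, cancel_mono, chartMap, specOverMap_comp,
    specOverMap_comp] at h
  congr 2
  refine AlgHom.ext fun x => chartRestrict_injective bot_le ?_
  exact DFunLike.congr_fun (specOverMap_injective h) x

/-- If a morphism from the torus to an affine scheme extends to each `X_τ`, where `τ` runs through a
set of cones, then it extends to `X_σ`, where `σ` is the cone spanned by them. Indeed,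
`σ^∨` is the intersection of the `τ^∨`. -/
lemma exists_chartMap_hull_eq {X : Over SpecC} {U : X.left.Opens} (hU : IsAffineOpen U)
    {C : Set (PointedCone ℝ (RealSpace N))} {σ : PointedCone ℝ (RealSpace N)}
    (hσ : σ = PointedCone.hull ℝ (⋃ τ ∈ C, (τ : Set (RealSpace N)))) (hC : C.Nonempty)
    {f : affineChart ⊥ ⟶ X}
    (hf : ∀ τ ∈ C, ∃ g : affineChart τ ⟶ X, (∀ x, g.left x ∈ U) ∧ chartMap bot_le ≫ g = f) :
    ∃ g : affineChart σ ⟶ X, (∀ x, g.left x ∈ U) ∧ chartMap bot_le ≫ g = f := by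
  obtain ⟨B, _, _, j, _, rfl⟩ := exists_specOver_of_isAffineOpen hU
  have := mono_of_isOpenImmersion j
  have hmem : ∀ x, f.left x ∈ j.left.opensRange := by
    obtain ⟨τ, hτ⟩ := hC
    obtain ⟨g, hg, rfl⟩ := hf τ hτ
    exact fun x => hg ((chartMap bot_le).left x)
  obtain ⟨f', rfl⟩ := exists_lift_of_isOpenImmersion j f hmem
  obtain ⟨a, rfl⟩ := exists_specOverMap_eq f'
  have ha : ∀ τ ∈ C, ∀ b, a b ∈ (chartRestrict (bot_le : ⊥ ≤ τ)).range := by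
    intro τ hτ b
    obtain ⟨g, hg, hgf⟩ := hf τ hτ
    obtain ⟨g', rfl⟩ := exists_lift_of_isOpenImmersion j g hg
    obtain ⟨c, rfl⟩ := exists_specOverMap_eq g'
    rw [← Category.assoc, cancel_mono, chartMap, specOverMap_comp] at hgf
    exact ⟨c b, DFunLike.congr_fun (specOverMap_injective hgf) b⟩
  have hσa : ∀ b, a b ∈ (chartRestrict (bot_le : ⊥ ≤ σ)).range := by
    intro b
    refine (mem_range_chartRestrict_iff _).2 fun m hm => ?_
    subst hσ
    refine fun x hx => nonneg_of_mem_hull ?_ hx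
    simp only [Set.mem_iUnion]
    rintro y ⟨τ, hτ, hy⟩
    exact (mem_range_chartRestrict_iff _).1 (ha τ hτ b) m hm y hy
  let c : B →ₐ[ℂ] ChartRing σ := (AlgEquiv.ofInjective (chartRestrict (bot_le : ⊥ ≤ σ))
    (chartRestrict_injective _)).symm.toAlgHom.comp (a.codRestrict _ hσa)
  have hc : (chartRestrict bot_le).comp c = a := by
    refine AlgHom.ext fun b => ?_
    exact congrArg Subtype.val ((AlgEquiv.ofInjective (chartRestrict (bot_le : ⊥ ≤ σ))
      (chartRestrict_injective _)).apply_symm_apply (a.codRestrict _ hσa b))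
  refine ⟨specOverMap c ≫ j, fun x => ⟨(specOverMap c).left x, rfl⟩, ?_⟩
  rw [← Category.assoc, chartMap, specOverMap_comp, hc]

end Torus

/-! ### The morphism from `X_S` to `X_S̃` -/

namespace SimplicialAffineSystem

variable {N : Type} [AddCommGroup N] [Module.Free ℤ N] [Module.Finite ℤ N]
  {I : Type} (S : SimplicialAffineSystem N I)

/-- The label `[τ, i]` of a chart of `X_S̃`, regarded as the label of a chart of `X_S`. -/
abbrev ofReductionIndex (p : S.reduction.Index) : S.Index :=
  ⟨p.cone, p.idx, S.mem_fan_self_iff.2 (by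
    have h := S.mem_reduction_iff.1 p.mem
    rwa [S.hullCone_self] at h)⟩

lemma chartι_ofReductionIndex (p : S.reduction.Index) :
    S.chartι (S.ofReductionIndex p) ≫ S.reductionMap = S.reduction.chartι p :=
  S.chartι_reductionMap (S.ofReductionIndex p)

/-- The morphism `X_S → X_S̃` is an epimorphism. -/
lemma reductionMap_hom_ext {W : Over SpecC} {f g : S.reduction.scheme ⟶ W}
    (h : S.reductionMap ≫ f = S.reductionMap ≫ g) : f = g :=
  S.reduction.hom_ext fun p => by
    rw [← chartι_ofReductionIndex]
    exact congrArg (S.chartι (S.ofReductionIndex p) ≫ ·) h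

lemma isToricMorphism_reductionMap [Nonempty I] :
    IsToricMorphism S.toricPrevariety S.reduction.toricPrevariety S.reductionMap := by
  refine ⟨?_, 𝟙 _, inferInstance, S.tensor_hom_ext fun p => ?_⟩
  · let p := S.maxIndex (Classical.arbitrary I)
    rw [S.base_eq p, S.reduction.base_eq (S.reductionIndex p)]
    exact congrArg (chartPoint p.cone ≫ ·) (S.chartι_reductionMap p)
  · have h1 : torus N ◁ S.chartι p ≫ S.act ≫ S.reductionMap =
        chartAct p.cone ≫ S.chartι p ≫ S.reductionMap := by
      rw [← Category.assoc, whiskerLeft_chartι_act, Category.assoc]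
    have h2 : torus N ◁ S.chartι p ≫ (𝟙 (torus N) ⊗ₘ S.reductionMap) =
        torus N ◁ (S.chartι p ≫ S.reductionMap) := by
      rw [id_tensorHom, MonoidalCategory.whiskerLeft_comp]
    refine h1.trans ((congrArg (chartAct p.cone ≫ ·) (S.chartι_reductionMap p)).trans
      ((S.reduction.whiskerLeft_chartι_act (S.reductionIndex p)).symm.trans ?_))
    refine Eq.trans ?_ ((congrArg (· ≫ S.reduction.act) h2).symm.trans (Category.assoc _ _ _))
    exact congrArg (fun h => torus N ◁ h ≫ S.reduction.act) (S.chartι_reductionMap p).symm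

omit [Module.Free ℤ N] [Module.Finite ℤ N] in
lemma reductionIndex_le_reductionMaxIndex (i : I) (p : S.Index)
    (h : p.cone.IsFaceOf (S.fan p.idx i).hullCone) :
    S.reductionIndex p ≤ S.reductionMaxIndex i := by
  refine ⟨h.le.trans ?_, S.mem_reduction_iff.2 h⟩
  change _ ≤ (S.fan i i).hullCone
  rw [hullCone_self]
  exact (S.mem_fan_self_iff.1 (S.hullCone_mem_right _ i)).le

lemma chart_reductionMaxIndex (i : I) : S.reduction.chart (S.reductionMaxIndex i) =
    S.reduction.chart (S.reductionIndex (S.maxIndex i)) := by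
  refine le_antisymm (S.reduction.chart_mono ⟨(S.hullCone_self i).le, .refl _⟩)
    (S.reduction.chart_mono (S.reductionIndex_le_reductionMaxIndex i _ ?_))
  change (S.maxCone i).IsFaceOf (S.fan i i).hullCone
  rw [hullCone_self]

lemma exists_iso_chart (i : I) : ∃ e : (S.chart (S.maxIndex i)).toScheme ≅
      (S.reduction.chart (S.reductionMaxIndex i)).toScheme,
    e.hom ≫ (S.reduction.chart (S.reductionMaxIndex i)).ι =
      (S.chart (S.maxIndex i)).ι ≫ S.reductionMap.left := by
  rw [chart_reductionMaxIndex]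
  have h : IsOpenImmersion (S.reduction.chartι (S.reductionIndex (S.maxIndex i))).left :=
    inferInstance
  exact @exists_iso_opensRange _ _ _ (S.chartι (S.maxIndex i)).left _ inferInstance h _
    (congrArg CommaMorphism.left (S.chartι_reductionMap (S.maxIndex i)))

lemma preimage_chart_reductionMaxIndex (i : I) :
    S.reductionMap.left ⁻¹ᵁ S.reduction.chart (S.reductionMaxIndex i) =
      ⨆ j : I, S.chart (S.hullIndex i j) := by
  refine le_antisymm (fun x hx => ?_) (iSup_le fun j => ?_)
  · obtain ⟨k, y, rfl⟩ := S.exists_chartι_eq x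
    obtain ⟨y', hy'⟩ := hx
    rw [← Scheme.Hom.comp_apply, ← Over.comp_left, chartι_reductionMap] at hy'
    obtain ⟨r, h1, h2, z, -, rfl⟩ := S.reduction.chartι_eq_iff.1 hy'
    refine TopologicalSpace.Opens.mem_iSup.2 ⟨k, ?_⟩
    have hr : r.cone.IsFaceOf (S.fan i k).hullCone := by
      refine S.mem_reduction_iff.1 (S.reduction.inter_subset i r.idx k ⟨?_, h2.2⟩)
      rw [S.reduction.symm]
      exact h1.2
    let q : S.Index := ⟨r.cone, k, (S.fan k k).face_mem _ (S.hullCone_mem_right i k) _ hr⟩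
    have h3 : q ≤ S.hullIndex i k := ⟨hr.le, q.mem⟩
    refine S.chart_mono h3 ⟨z, ?_⟩
    rw [← S.chartMap_chartι (S.le_maxIndex q)]
    rfl
  · have h : S.reductionIndex (S.hullIndex i j) ≤ S.reductionMaxIndex i := by
      refine S.reductionIndex_le_reductionMaxIndex i _ ?_
      change (S.fan i j).hullCone.IsFaceOf (S.fan j i).hullCone
      rw [S.symm j i]
    rintro _ ⟨y, rfl⟩
    refine S.reduction.chart_mono h ⟨y, ?_⟩
    rw [← chartι_reductionMap]
    rfl

end SimplicialAffineSystem

namespace SimplicialAffineSystem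

variable {N : Type} [AddCommGroup N] [Module.Free ℤ N] [Module.Finite ℤ N]
  {I : Type} (S : SimplicialAffineSystem N I)

/-- The label of the chart `X_[σ̃ i j, i]` of `X_S`, where `σ̃ i j = conv |Δ i j|`. -/
abbrev leftHullIndex (i j : I) : S.Index := ⟨(S.fan i j).hullCone, i, S.hullCone_mem_left i j⟩

/-- The charts `X_[τ, i]` and `X_[τ, j]` coincide if `τ ∈ Δ i j`. -/
lemma chartι_eq_of_mem {i j : I} {τ : PointedCone ℝ (RealSpace N)} (h : τ ∈ (S.fan i j).cones)
    (hi : τ ∈ (S.fan i i).cones) (hj : τ ∈ (S.fan j j).cones) :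
    S.chartι ⟨τ, i, hi⟩ = S.chartι ⟨τ, j, hj⟩ := by
  have hle : (⟨τ, i, hi⟩ : S.Index) ≤ ⟨τ, j, hj⟩ := ⟨le_rfl, h⟩
  rw [← S.chartMap_chartι hle, chartMap_refl]
  exact (Category.id_comp _).symm

/-! ### Affine intersection -/

/-- Two of the affine open subschemes from which `X_S̃` is glued meet in a single chart. -/
lemma reduction_chart_inf (i j : I) :
    S.reduction.chart (S.reduction.maxIndex i) ⊓ S.reduction.chart (S.reduction.maxIndex j) =
      S.reduction.chart (S.reductionIndex (S.leftHullIndex i j)) := by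
  have hij : S.reductionIndex (S.leftHullIndex i j) ≤ S.reductionIndex (S.hullIndex i j) :=
    ⟨le_rfl, .refl _⟩
  refine le_antisymm ?_ (le_inf (S.reduction.chart_mono (S.reduction.le_maxIndex _))
    (S.reduction.chart_mono (hij.trans (S.reduction.le_maxIndex _))))
  rintro x ⟨⟨y, rfl⟩, ⟨y', hy'⟩⟩
  obtain ⟨r, h1, h2, z, -, rfl⟩ := S.reduction.chartι_eq_iff.1 hy'
  have hr : r.cone ∈ (S.reduction.fan i j).cones :=
    S.reduction.inter_subset i r.idx j ⟨by rw [S.reduction.symm]; exact h2.2, h1.2⟩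
  have hri : r ≤ S.reductionIndex (S.leftHullIndex i j) :=
    ⟨(S.mem_reduction_iff.1 hr).le, h2.2⟩
  refine S.reduction.chart_mono hri ⟨z, ?_⟩
  rw [← S.reduction.chartMap_chartι h2]
  rfl

/-- The `X_[σ i i, i]` cover `X_S`, so one of them contains a given maximal stable affine chart. -/
lemma exists_eq_chart_maxIndex [Finite I] [Nonempty I] {U : S.scheme.left.Opens}
    (hU : Maximal S.toricPrevariety.IsChart U) : ∃ i, U = S.chart (S.maxIndex i) := by
  have hne : (U : Set S.scheme.left).Nonempty := by
    let i : I := Classical.arbitrary I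
    by_contra h
    have hbot : U ≤ S.chart (S.maxIndex i) := fun x hx => (h ⟨x, hx⟩).elim
    have x : PrimeSpectrum (ChartRing (S.maxIndex i).cone) := Classical.arbitrary _
    exact h ⟨(S.chartι (S.maxIndex i)).left x,
      hU.2 (S.isChart_chart (S.maxIndex i)) hbot ⟨x, rfl⟩⟩
  obtain ⟨i, hi⟩ := S.isToricPrevariety.exists_le_of_le_iSup hU.1 hne
    (fun i => S.chart (S.maxIndex i)) (fun i => S.isStable_chart _)
    (le_top.trans S.iSup_chart_maxIndex.ge)
  exact ⟨i, hU.eq_of_le (S.isChart_chart _) hi⟩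

theorem isOfAffineIntersection_reduction [Finite I] [Nonempty I] :
    S.reduction.toricPrevariety.IsOfAffineIntersection := by
  intro U U' hU hU'
  obtain ⟨i, rfl⟩ := S.reduction.exists_eq_chart_maxIndex hU
  obtain ⟨j, rfl⟩ := S.reduction.exists_eq_chart_maxIndex hU'
  have h := S.reduction.isAffineOpen_chart (S.reductionIndex (S.leftHullIndex i j))
  rw [← reduction_chart_inf] at h
  exact h

/-! ### The universal property -/

section Universal

variable [Finite I] [Nonempty I] {N' : Type} [AddCommGroup N'] {Y : TorusScheme N'}
  (hY : Y.IsToricPrevariety)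
  {f : S.scheme ⟶ Y.X} (hf : IsToricMorphism S.toricPrevariety Y f)

include hY hf

/-- A toric morphism maps each chart into a maximal stable affine chart. -/
lemma exists_maximal_forall_mem (i : I) : ∃ V, Maximal Y.IsChart V ∧
    ∀ p : S.Index, p.idx = i → ∀ x, (S.chartι p ≫ f).left x ∈ V := by
  have x₀ : PrimeSpectrum (ChartRing (S.maxIndex i).cone) := Classical.arbitrary _
  obtain ⟨⟨U, hU⟩, h⟩ := S.isToricPrevariety.exists_le_of_le_iSup (S.isChart_chart (S.maxIndex i))
    ⟨_, x₀, rfl⟩ (fun U : {U // Y.IsChart U} => f.left ⁻¹ᵁ U.1)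
    (fun U => hf.isStable_preimage U.2.2) (fun x _ => by
      obtain ⟨U, hx, hU⟩ := hY.exists_chart (f.left x)
      exact TopologicalSpace.Opens.mem_iSup.2 ⟨⟨U, hU⟩, hx⟩)
  obtain ⟨V, hUV, hV⟩ := hY.exists_le_maximal hU
  refine ⟨V, hV, ?_⟩
  rintro p rfl x
  exact hUV (h (S.chart_mono (S.le_maxIndex p) ⟨x, rfl⟩))

/-- A toric morphism to a toric prevariety of affine intersection takes the same values on the
charts `X_[σ̃ i j, i]` and `X_[σ̃ i j, j]`. -/
lemma chartι_leftHullIndex_comp (hYa : Y.IsOfAffineIntersection) (i j : I) :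
    S.chartι (S.leftHullIndex i j) ≫ f = S.chartι (S.hullIndex i j) ≫ f := by
  obtain ⟨V, hV, hVi⟩ := S.exists_maximal_forall_mem hY hf i
  obtain ⟨V', hV', hVj⟩ := S.exists_maximal_forall_mem hY hf j
  -- the restriction of `f` to the torus extends to a morphism `X_σ̃ → V ⊓ V'`
  obtain ⟨g, hg, hgf⟩ := exists_chartMap_hull_eq (hYa V V' hV hV') (C := (S.fan i j).cones)
    (σ := (S.fan i j).hullCone) rfl (S.fan i j).nonempty (f := S.chartι (S.botIndex i) ≫ f)
    (fun τ hτ => by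
      let p : S.Index := ⟨τ, i, S.fan_subset_left i j hτ⟩
      let q : S.Index := ⟨τ, j, S.fan_subset_right i j hτ⟩
      have hpq' : S.chartι p = S.chartι q := S.chartι_eq_of_mem hτ _ _
      refine ⟨S.chartι p ≫ f, fun x => ⟨hVi p rfl x, ?_⟩, ?_⟩
      · rw [hpq']
        exact hVj q rfl x
      · exact (Category.assoc _ _ _).symm.trans
          (congrArg (· ≫ f) (S.chartMap_chartι (S.botIndex_le i p))))
  -- it agrees with `f` on both charts, as `V` and `V'` are affine
  have hbot : S.chartι (S.botIndex j) = S.chartι (S.botIndex i) :=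
    (S.chartι_eq_of_mem (S.fan i j).bot_mem _ _).symm
  have h1 : S.chartι (S.leftHullIndex i j) ≫ f = g := by
    refine affineChart_hom_ext hV.1.1 (hVi _ rfl) (fun x => (hg x).1) (Eq.trans ?_ hgf.symm)
    exact (Category.assoc _ _ _).symm.trans
      (congrArg (· ≫ f) (S.chartMap_chartι (S.botIndex_le i (S.leftHullIndex i j))))
  have h2 : S.chartι (S.hullIndex i j) ≫ f = g := by
    refine affineChart_hom_ext hV'.1.1 (hVj _ rfl) (fun x => (hg x).2) (Eq.trans ?_ hgf.symm)
    exact (Category.assoc _ _ _).symm.trans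
      (congrArg (· ≫ f) ((S.chartMap_chartι (S.botIndex_le j (S.hullIndex i j))).trans hbot))
  exact h1.trans h2.symm

/-- The restrictions of a toric morphism to the charts of `X_S` are compatible with the inclusions
among the charts of `X_S̃`. -/
lemma chartMap_ofReductionIndex (hYa : Y.IsOfAffineIntersection) {p q : S.reduction.Index}
    (h : p ≤ q) : chartMap h.1 ≫ S.chartι (S.ofReductionIndex q) ≫ f =
      S.chartι (S.ofReductionIndex p) ≫ f := by
  have hface := S.mem_reduction_iff.1 h.2
  have h1 : S.ofReductionIndex p ≤ S.leftHullIndex p.idx q.idx :=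
    ⟨hface.le, (S.ofReductionIndex p).mem⟩
  let r : S.Index := ⟨p.cone, q.idx, (S.fan _ _).face_mem _ (S.hullCone_mem_right _ _) _ hface⟩
  have h2 : r ≤ S.hullIndex p.idx q.idx := ⟨hface.le, r.mem⟩
  have h3 : r ≤ S.ofReductionIndex q := ⟨h.1, r.mem⟩
  rw [← Category.assoc]
  refine (congrArg (· ≫ f) (S.chartMap_chartι h3)).trans ?_
  rw [← S.chartMap_chartι h2, ← S.chartMap_chartι h1, Category.assoc, Category.assoc,
    S.chartι_leftHullIndex_comp hY hf hYa]
  rfl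

/-- A toric morphism to a toric prevariety of affine intersection factors through `X_S̃`: its
restrictions to the charts are compatible with the gluing of `X_S̃`. -/
theorem exists_reductionMap_comp_eq (hYa : Y.IsOfAffineIntersection) :
    ∃ f' : S.reduction.scheme ⟶ Y.X, S.reductionMap ≫ f' = f := by
  let c : Cocone S.reduction.diagram :=
    { pt := Y.X.left
      ι := { app := fun p => (S.chartι (S.ofReductionIndex p) ≫ f).left
             naturality := fun p q h =>
              (congrArg CommaMorphism.left
                (S.chartMap_ofReductionIndex hY hf hYa (leOfHom h))).trans
                (Category.comp_id _).symm } }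
  let f' : S.reduction.scheme ⟶ Y.X :=
    Over.homMk (colimit.desc S.reduction.diagram c) (colimit.hom_ext fun p =>
      (colimit.ι_desc_assoc c p Y.X.hom).trans
        ((Over.w (S.chartι (S.ofReductionIndex p) ≫ f)).trans
          (Over.w (S.reduction.chartι p)).symm))
  have hf' : ∀ p, S.reduction.chartι p ≫ f' = S.chartι (S.ofReductionIndex p) ≫ f := fun p => by
    ext1
    exact colimit.ι_desc c p
  refine ⟨f', S.hom_ext fun p => ?_⟩
  rw [← Category.assoc, chartι_reductionMap]
  exact hf' (S.reductionIndex p)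

omit hY [Finite I] in
/-- Equivariance can be tested on the charts, and each chart of `X_S̃` factors through `X_S`. -/
lemma isToricMorphism_of_reductionMap_comp_eq {f' : S.reduction.scheme ⟶ Y.X}
    (h : S.reductionMap ≫ f' = f) : IsToricMorphism S.reduction.toricPrevariety Y f' := by
  obtain ⟨hb, φ, hφ, hact⟩ := hf
  obtain ⟨hb', -⟩ := S.isToricMorphism_reductionMap
  have hp : ∀ p, S.reduction.chartι p ≫ f' = S.chartι (S.ofReductionIndex p) ≫ f := fun p => by
    rw [← h, ← Category.assoc, chartι_ofReductionIndex]
  refine ⟨?_, φ, hφ, S.reduction.tensor_hom_ext fun p => ?_⟩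
  · rw [← hb']
    exact (Category.assoc _ _ _).trans ((congrArg _ h).trans hb)
  · have h1 : torus N ◁ S.reduction.chartι p ≫ S.reduction.act ≫ f' =
        chartAct p.cone ≫ S.reduction.chartι p ≫ f' := by
      rw [← Category.assoc, whiskerLeft_chartι_act, Category.assoc]
    have h2 : torus N ◁ S.chartι (S.ofReductionIndex p) ≫ S.act ≫ f =
        chartAct p.cone ≫ S.chartι (S.ofReductionIndex p) ≫ f := by
      rw [← Category.assoc, whiskerLeft_chartι_act, Category.assoc]
    have h3 : torus N ◁ S.chartι (S.ofReductionIndex p) ≫ (φ ⊗ₘ f) ≫ Y.act =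
        (φ ⊗ₘ (S.chartι (S.ofReductionIndex p) ≫ f)) ≫ Y.act := by
      rw [← id_tensorHom, ← Category.assoc, MonoidalCategory.tensorHom_comp_tensorHom,
        Category.id_comp]
    have h4 : torus N ◁ S.reduction.chartι p ≫ (φ ⊗ₘ f') ≫ Y.act =
        (φ ⊗ₘ (S.reduction.chartι p ≫ f')) ≫ Y.act := by
      rw [← id_tensorHom, ← Category.assoc, MonoidalCategory.tensorHom_comp_tensorHom,
        Category.id_comp]
    refine h1.trans (Eq.trans ?_ h4.symm)
    rw [hp, ← h2, ← h3]
    exact congrArg _ hact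

end Universal

/-! ### Smoothness -/

/-- The charts of `X_S̃` are isomorphic to charts of `X_S`. -/
theorem smooth_reduction (h : Smooth S.scheme.hom) : Smooth S.reduction.scheme.hom := by
  have : IsZariskiLocalAtSource @Smooth :=
    HasRingHomProperty.instIsZariskiLocalAtSource (Q := RingHom.Smooth)
  refine (IsZariskiLocalAtSource.iff_of_openCover S.reduction.cover).2 fun p => ?_
  change Smooth ((S.reduction.chartι p).left ≫ S.reduction.scheme.hom)
  have h1 : Smooth ((S.chartι (S.ofReductionIndex p)).left ≫ S.scheme.hom) := inferInstance
  rw [Over.w] at h1 ⊢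
  exact h1

end SimplicialAffineSystem

end ToricPrevarieties

theorem proposition1p1 {N : Type} [AddCommGroup N] [Module.Free ℤ N] [Module.Finite ℤ N]
    {I : Type} [Finite I] [Nonempty I] (S : SimplicialAffineSystem N I) :
    S.toricPrevariety.IsToricPrevariety ∧
    S.reduction.toricPrevariety.IsToricPrevariety ∧
    S.reduction.toricPrevariety.IsOfAffineIntersection ∧
    IsToricMorphism S.toricPrevariety S.reduction.toricPrevariety S.reductionMap ∧
    (∀ i : I, ∃ e : (S.chart (S.maxIndex i)).toScheme ≅
        (S.reduction.chart (S.reductionMaxIndex i)).toScheme,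
      e.hom ≫ (S.reduction.chart (S.reductionMaxIndex i)).ι =
        (S.chart (S.maxIndex i)).ι ≫ S.reductionMap.left) ∧
    (∀ i : I, S.reductionMap.left ⁻¹ᵁ S.reduction.chart (S.reductionMaxIndex i) =
      ⨆ j : I, S.chart (S.hullIndex i j)) ∧
    (∀ (N' : Type) [AddCommGroup N'] [Module.Free ℤ N'] [Module.Finite ℤ N']
      (Y : TorusScheme N'), Y.IsToricPrevariety → Y.IsOfAffineIntersection →
      ∀ f : S.scheme ⟶ Y.X, IsToricMorphism S.toricPrevariety Y f →
      ∃! f' : S.reduction.scheme ⟶ Y.X,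
        IsToricMorphism S.reduction.toricPrevariety Y f' ∧ S.reductionMap ≫ f' = f) ∧
    (Smooth S.scheme.hom → Smooth S.reduction.scheme.hom) := by
  refine ⟨S.isToricPrevariety, S.reduction.isToricPrevariety, S.isOfAffineIntersection_reduction,
    S.isToricMorphism_reductionMap, S.exists_iso_chart, S.preimage_chart_reductionMaxIndex, ?_,
    S.smooth_reduction⟩
  intro N' _ _ _ Y hY hYa f hf
  obtain ⟨f', hf'⟩ := S.exists_reductionMap_comp_eq hY hf hYa
  exact ⟨f', ⟨S.isToricMorphism_of_reductionMap_comp_eq hf hf', hf'⟩,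
    fun h hh => S.reductionMap_hom_ext (hh.2.trans hf'.symm)⟩
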